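/- Let $M=\sum_{i=1}^d\sigma_iu_iu_i^\top\in\mathbb R^{n\times n}$ with $u_1,\dots,u_d$ orthonormal and $\sigma_1\ge\dots\ge\sigma_d>0$, and put $\sigma_i=0$ for $i>d$. Let $1\le k\le d$ and suppose $\sigma_i>\sigma_{i+1}$ for all $i\le k$. Let $0<\varepsilon\le\frac12\min_{i\le k}\frac{\sigma_i-\sigma_{i+1}}{\sigma_i}$. For a symmetric matrix $A$ and a vector $g$, rank-1 gradient descent on $A$ from the draw $g$ is $$x_0=Ag,\qquad x_{t+1}=x_t-\frac{1}{2\|x_t\|^2}\nabla f_A(x_t),\qquad f_A(x)=\tfrac14\|A-xx^\top\|_F^2 .$$ Let $g_1,\dots,g_k$ be independent standard Gaussian vectors in $\mathbb R^n$. Sequential deflation with iteration counts $t_1,\dots,t_k\in\mathbb N$ is as follows: for $\ell=1,\dots,k$, run $t_\ell$ such iterations on $M_\ell=M-\sum_{i<\ell}\hat\sigma_i\hat u_i\hat u_i^\top$ from the draw $g_\ell$, and from the last iterate $x$ set $\hat\sigma_\ell=\|x\|^2$, $\hat u_\ell=x/\|x\|$. Let $\lambda_\ell$ be the largest eigenvalue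 of $M_\ell$, let $\theta_\ell$ be the angle between the initial point $x_0^{(\ell)}=M_\ell g_\ell$ and the corresponding eigenspace, and let $$q_\ell=\min\Big\{|\cos\theta_\ell|,\ \frac{\|x_0^{(\ell)}\|}{\lambda_\ell},\ \frac{\lambda_\ell}{\|x_0^{(\ell)}\|}\Big\}.$$ Write $$\Gamma=\max_{i\le k}\frac{\sigma_i}{\sigma_i-\sigma_{i+1}},\qquad L=\log\Big(\frac{\sigma_1}{\sigma_k}\,\Gamma\,\frac k\varepsilon\Big),\qquad L'=\log\Big(e\Big(\sigma_1+\frac1{\sigma_k}\Big)\Big).$$ There are functions $C_1,C_2:\mathbb R\to\mathbb R$, positive and non-increasing on $(0,\infty)$ and independent of $n,d,k,M,\varepsilon$ and of the draws, such that for all data as above the following holds almost surely. 1. For all $t_1,\dots,t_k$ such that $t_\ell\ge C_1(q_\ell)\,\Gamma L+C_2(q_\ell)\,L'$ for every $\ell\le k$, one has, for every $\ell\le k$, $q_\ell>0$ and $$|\sigma_\ell-\hat\sigma_\ell|\le\varepsilon\sigma_\ell,\qquad \min(\|u_\ell-\hat u_\ell\|,\|u_\ell+\hat u_\ell\|)\le\varepsilon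 .\tag{$*$}$$ 2. There are $t_1,\dots,t_k$ and $q>0$ such that $q_\ell\ge q$ and $(*)$ hold for every $\ell\le k$, and the total iteration count satisfies $$t_1+\dots+t_k\le C_1(q)\,k\,\Gamma L+C_2(q)\,k\,L'.$$ -/

import Mathlib

open MeasureTheory ProbabilityTheory

noncomputable section

/-- The space `ℝⁿ` with its Euclidean norm. -/
abbrev Vec (n : ℕ) : Type := EuclideanSpace ℝ (Fin n)

/-- The matrix `x xᵀ`. -/
def outer {n : ℕ} (x : Vec n) : Matrix (Fin n) (Fin n) ℝ := Matrix.of fun i j => x i * x j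

/-- The rank-one approximation objective `g(x; A) = ¼ ‖A - x xᵀ‖_F²`. -/
def rankOneLoss {n : ℕ} (A : Matrix (Fin n) (Fin n) ℝ) (x : Vec n) : ℝ :=
  (1 / 4) * ∑ i, ∑ j, (A i j - outer x i j) ^ 2

/-- One gradient step with step size `½ / ‖x‖²`. -/
def gradStep {n : ℕ} (A : Matrix (Fin n) (Fin n) ℝ) (x : Vec n) : Vec n :=
  x - ((1 / 2) / ‖x‖ ^ 2) • gradient (rankOneLoss A) x

/-- The initial point `A g` obtained from a draw `g`. -/
def initPoint {n : ℕ} (A : Matrix (Fin n) (Fin n) ℝ) (g : Vec n) : Vec n :=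
  A.toEuclideanLin g

/-- The `t`-th iterate of gradient descent on `g(·; A)` started at `A g`. -/
def gdIterate {n : ℕ} (A : Matrix (Fin n) (Fin n) ℝ) (g : Vec n) (t : ℕ) : Vec n :=
  (gradStep A)^[t] (initPoint A g)

/-- The estimate `‖x_t‖²` of the leading eigenvalue of `A`. -/
def estValue {n : ℕ} (A : Matrix (Fin n) (Fin n) ℝ) (g : Vec n) (t : ℕ) : ℝ :=
  ‖gdIterate A g t‖ ^ 2

/-- The estimate `x_t / ‖x_t‖` of the leading eigenvector of `A`. -/
def estVector {n : ℕ} (A : Matrix (Fin n) (Fin n) ℝ) (g : Vec n) (t : ℕ) : Vec n :=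
  ‖gdIterate A g t‖⁻¹ • gdIterate A g t

/-- Sequential deflation. Stages are numbered from `0`: stage `ℓ` runs `t ℓ` gradient steps on
`deflated M g t ℓ`, starting from the draw `g ℓ`, and the estimate found is then subtracted, so
`deflated M g t ℓ = M - ∑_{i < ℓ} σ̂ᵢ ûᵢ ûᵢᵀ`. -/
def deflated {n : ℕ} (M : Matrix (Fin n) (Fin n) ℝ) (g : ℕ → Vec n) (t : ℕ → ℕ) :
    ℕ → Matrix (Fin n) (Fin n) ℝ
  | 0 => M
  | ℓ + 1 => deflated M g t ℓ -
      estValue (deflated M g t ℓ) (g ℓ) (t ℓ) • outer (estVector (deflated M g t ℓ) (g ℓ) (t ℓ))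

/-- The output `σ̂` of stage `ℓ`. -/
def sigmaHat {n : ℕ} (M : Matrix (Fin n) (Fin n) ℝ) (g : ℕ → Vec n) (t : ℕ → ℕ) (ℓ : ℕ) : ℝ :=
  estValue (deflated M g t ℓ) (g ℓ) (t ℓ)

/-- The output `û` of stage `ℓ`. -/
def uHat {n : ℕ} (M : Matrix (Fin n) (Fin n) ℝ) (g : ℕ → Vec n) (t : ℕ → ℕ) (ℓ : ℕ) : Vec n :=
  estVector (deflated M g t ℓ) (g ℓ) (t ℓ)

/-- The largest eigenvalue of a symmetric matrix. -/
def topEigenvalue {n : ℕ} (A : Matrix (Fin n) (Fin n) ℝ) : ℝ :=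
  sSup {μ : ℝ | Module.End.HasEigenvalue A.toEuclideanLin μ}

/-- `|cos θ|`, where `θ` is the angle between `x` and the eigenspace of the largest eigenvalue
of `A` (the angle between `x` and the leading eigenvector, if that eigenvalue is simple). -/
def topCos {n : ℕ} (A : Matrix (Fin n) (Fin n) ℝ) (x : Vec n) : ℝ :=
  ‖(Module.End.eigenspace A.toEuclideanLin (topEigenvalue A)).starProjection x‖ / ‖x‖

/-- The quality of an initial point `x` for the matrix `A`: the largest `q` such that
`|cos θ| ≥ q` and `q ≤ ‖x‖ / λ ≤ 1 / q`, where `λ` is the largest eigenvalue of `A`. -/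
def initQuality {n : ℕ} (A : Matrix (Fin n) (Fin n) ℝ) (x : Vec n) : ℝ :=
  min (topCos A x) (min (‖x‖ / topEigenvalue A) (topEigenvalue A / ‖x‖))

/-- The quality of the initial point of stage `ℓ`. -/
def stageQuality {n : ℕ} (M : Matrix (Fin n) (Fin n) ℝ) (g : ℕ → Vec n) (t : ℕ → ℕ)
    (ℓ : ℕ) : ℝ :=
  initQuality (deflated M g t ℓ) (initPoint (deflated M g t ℓ) (g ℓ))

/-- `max_{i < k} σᵢ / (σᵢ - σᵢ₊₁)`. -/
def maxGapRatio (σ : ℕ → ℝ) (k : ℕ) : ℝ := ⨆ i : Fin k, σ i / (σ i - σ (i + 1))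

/-- `max_{i < k} σᵢ/(σᵢ - σᵢ₊₁) · log ((σ₁/σ_k) · max_{i < k} σᵢ/(σᵢ - σᵢ₊₁) · k/ε)`; in the
numbering from `0` the largest value is `σ 0` and the `k`-th largest is `σ (k - 1)`. -/
def gapTerm (σ : ℕ → ℝ) (k : ℕ) (ε : ℝ) : ℝ :=
  maxGapRatio σ k * Real.log (σ 0 / σ (k - 1) * maxGapRatio σ k * (k / ε))

/-- `log (e (σ₁ + 1/σ_k))`. -/
def scaleTerm (σ : ℕ → ℝ) (k : ℕ) : ℝ := Real.log (Real.exp 1 * (σ 0 + 1 / σ (k - 1)))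

/-- Stage `ℓ` found the `ℓ`-th eigenpair `(s, v)` to accuracy `ε`. -/
def StageAccurate {n : ℕ} (M : Matrix (Fin n) (Fin n) ℝ) (g : ℕ → Vec n) (t : ℕ → ℕ)
    (ε : ℝ) (ℓ : ℕ) (s : ℝ) (v : Vec n) : Prop :=
  |s - sigmaHat M g t ℓ| ≤ ε * s ∧
    min ‖v - uHat M g t ℓ‖ ‖v + uHat M g t ℓ‖ ≤ ε

/-- The gradient of the objective for a symmetric matrix is `‖x‖² x - A x`. -/
theorem gradient_rankOneLoss {n : ℕ} (A : Matrix (Fin n) (Fin n) ℝ) (hA : A.IsSymm) (x : Vec n) :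
    gradient (rankOneLoss A) x = ‖x‖ ^ 2 • x - A.toEuclideanLin x := by
  apply HasGradientAt.gradient
  rw [hasGradientAt_iff_hasFDerivAt]
  have hc : ∀ i : Fin n, HasFDerivAt (fun y : Vec n => y i)
      (EuclideanSpace.proj (𝕜 := ℝ) i : Vec n →L[ℝ] ℝ) x := fun i =>
    (EuclideanSpace.proj (𝕜 := ℝ) i : Vec n →L[ℝ] ℝ).hasFDerivAt
  have h : HasFDerivAt (rankOneLoss A) _ x :=
    (HasFDerivAt.fun_sum (u := Finset.univ) fun i _ =>
      HasFDerivAt.fun_sum (u := Finset.univ) fun j _ =>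
        (((hc i).mul (hc j)).const_sub (A i j)).pow 2).const_mul (1 / 4 : ℝ)
  refine h.congr_fderiv ?_
  ext v
  have hs : ∀ i j, A j i = A i j := fun i j => hA.apply i j
  have hn : ‖x‖ ^ 2 = ∑ i, x i ^ 2 := EuclideanSpace.real_norm_sq_eq x
  have e1 : ∑ i, ∑ j, (A i j - x i * x j) * (x i * v j) =
      ∑ i, ∑ j, (A i j - x i * x j) * (x j * v i) := by
    rw [Finset.sum_comm]
    refine Finset.sum_congr rfl fun i _ => Finset.sum_congr rfl fun j _ => ?_
    rw [hs i j, mul_comm (x j) (x i)]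
  have e2 : inner ℝ (‖x‖ ^ 2 • x - A.toEuclideanLin x) v =
      -∑ i, ∑ j, (A i j - x i * x j) * (x j * v i) := by
    rw [PiLp.inner_apply, ← Finset.sum_neg_distrib]
    refine Finset.sum_congr rfl fun i _ => ?_
    simp only [PiLp.sub_apply, PiLp.smul_apply, smul_eq_mul, hn,
      Matrix.toLpLin_apply, Matrix.mulVec, dotProduct]
    simp only [RCLike.inner_apply, conj_trivial]
    rw [Finset.sum_mul, ← Finset.sum_sub_distrib, Finset.mul_sum, ← Finset.sum_neg_distrib]
    refine Finset.sum_congr rfl fun j _ => ?_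
    ring
  rw [InnerProductSpace.toDual_apply_apply, e2]
  have e3 : ∑ i, ∑ j, (-(2 * (A i j - x i * x j) * (x j * v i)) +
      -(2 * (A i j - x i * x j) * (x i * v j))) =
      -4 * ∑ i, ∑ j, (A i j - x i * x j) * (x j * v i) := by
    have e4 : ∀ i j, -(2 * (A i j - x i * x j) * (x j * v i)) +
        -(2 * (A i j - x i * x j) * (x i * v j)) =
        -2 * ((A i j - x i * x j) * (x j * v i)) +
          -2 * ((A i j - x i * x j) * (x i * v j)) := fun i j => by ring
    simp only [e4, Finset.sum_add_distrib, ← Finset.mul_sum, e1]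
    ring
  simp only [one_div, nsmul_eq_mul, Nat.cast_ofNat, Pi.mul_apply, Nat.add_one_sub_one, pow_one,
    smul_neg, smul_add, smul_apply, sum_apply, smul_eq_mul,
    neg_apply, add_apply, PiLp.proj_apply,
    neg_add_rev]
  rw [e3]
  ring

end

/-! For symmetric `A` the step is `x ↦ ½ (x + A x / ‖x‖²)`. Split `x` along a leading eigenvector
`v` and its complement, in units of `√λ`: with `s = b² + w²`, `b` is multiplied by `½ (1 + 1/s)` and
`w` by at most `½ (1 + m/s)`, where `m < 1` is the relative size of `A` on the complement of `v`.
Hence `w/b` shrinks by at least `(s + m)/(s + 1)`, as in the power method. After one step AM-GM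
keeps `b` above the cosine of the angle; large `b` is roughly halved at each step, so `s` becomes
bounded in terms of the quality `q` and the contraction is geometric. Once `w/b` is tiny, `b`
follows the Babylonian iteration for `√1` (`IterationSystem.converges`).

Comparing each stage with exact deflation alone would amplify the error by an inverse gap at every
stage. That comparison is used only crudely: `exists_leadingPair` gives `M_ℓ` a simple leading
eigenvalue, a relative gap of order `1/Γ`, and approximately the right eigenvalue. Accuracy comes
from another invariant: `M_ℓ` almost annihilates every earlier estimate, with an error that grows
additively (`Invariant.small_succ`). By symmetry of `M_ℓ` the new estimate `x_ℓ` is then almost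
orthogonal to the earlier ones, so adding back the subtracted terms shows that `x_ℓ` is an
approximate eigenvector of the original `M` (`Invariant.residual_le`). The gaps of `M` turn this
residual into closeness to `u_ℓ` and `σ_ℓ`, with the same tolerance `δ` at every stage
(`Invariant.succ`).

A stage has positive quality unless its draw is orthogonal to the leading eigenvector. For fixed
counts `M_ℓ` is independent of `g_ℓ`, and a Gaussian does not charge hyperplanes, so Fubini makes
failure null. Only countably many tuples of counts matter, hence one null set serves all counts,
even those chosen from the draws (`ae_quality_pos`). Taking the least sufficient count at each stage
and the least quality gives the total. -/

noncomputable section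

open scoped RealInnerProductSpace

/-! ### The scalar comparison system -/

/-- The two-dimensional comparison system for the rank-one iteration: `b` is the component along
the leading eigenvector and `w` the norm of the orthogonal component, in units of `√λ`. -/
structure IterationSystem (b w : ℕ → ℝ) (m : ℝ) : Prop where
  pos : 0 < b 0
  nonneg : ∀ t, 0 ≤ w t
  ratio_nonneg : 0 ≤ m
  ratio_le_one : m ≤ 1
  main_step : ∀ t, b (t + 1) = 1 / 2 * (1 + 1 / (b t ^ 2 + w t ^ 2)) * b t
  perp_step : ∀ t, w (t + 1) ≤ 1 / 2 * (1 + m / (b t ^ 2 + w t ^ 2)) * w t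

namespace IterationSystem

variable {b w : ℕ → ℝ} {m : ℝ}

theorem main_pos (h : IterationSystem b w m) : ∀ t, 0 < b t
  | 0 => h.pos
  | t + 1 => by
    have := h.main_pos t
    rw [h.main_step t]
    positivity

theorem sq_pos (h : IterationSystem b w m) (t : ℕ) : 0 < b t ^ 2 + w t ^ 2 := by
  have := h.main_pos t
  positivity

theorem tan_step (h : IterationSystem b w m) {t : ℕ} {K : ℝ} (hK : w t ≤ K * b t) :
    w (t + 1) ≤ ((b t ^ 2 + w t ^ 2 + m) / (b t ^ 2 + w t ^ 2 + 1)) * K * b (t + 1) := by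
  have hs := h.sq_pos t
  have hm := h.ratio_nonneg
  rw [h.main_step t]
  refine (h.perp_step t).trans ?_
  generalize b t ^ 2 + w t ^ 2 = s at *
  calc 1 / 2 * (1 + m / s) * w t ≤ 1 / 2 * (1 + m / s) * (K * b t) := by gcongr
    _ = (s + m) / (s + 1) * K * (1 / 2 * (1 + 1 / s) * b t) := by field_simp

theorem tan_antitone (h : IterationSystem b w m) {K : ℝ} (hK0 : 0 ≤ K) {t : ℕ}
    (hK : w t ≤ K * b t) : ∀ j, w (t + j) ≤ K * b (t + j)
  | 0 => hK
  | j + 1 => by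
    have hs := h.sq_pos (t + j)
    have hb := h.main_pos (t + j + 1)
    have hm := h.ratio_le_one
    have := h.tan_step (h.tan_antitone hK0 hK j)
    refine this.trans ?_
    have h1 : (b (t + j) ^ 2 + w (t + j) ^ 2 + m) / (b (t + j) ^ 2 + w (t + j) ^ 2 + 1) ≤ 1 := by
      rw [div_le_one (by positivity)]; linarith
    have : 0 ≤ K * b (t + j + 1) := by positivity
    rw [mul_assoc]
    exact mul_le_of_le_one_left this h1

/-- The factor in `tan_step` is `1 - (1 - m)/(s + 1)`, so an upper bound on `s` makes the decay
geometric. -/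
theorem tan_contract (h : IterationSystem b w m) {K S : ℝ} (hK0 : 0 ≤ K) {t : ℕ}
    (hS : ∀ j, b (t + j) ^ 2 + w (t + j) ^ 2 + 1 ≤ S)
    (hK : w t ≤ K * b t) : ∀ j, w (t + j) ≤ (1 - (1 - m) / S) ^ j * K * b (t + j)
  | 0 => by simpa using hK
  | j + 1 => by
    have hs := h.sq_pos (t + j)
    have hb := h.main_pos (t + j + 1)
    have hm := h.ratio_le_one
    have hm0 := h.ratio_nonneg
    have hSj := hS j
    have := h.tan_step (h.tan_contract hK0 hS hK j)
    refine this.trans ?_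
    have hr : 0 ≤ 1 - (1 - m) / S := by
      rw [sub_nonneg, div_le_one (by linarith)]; linarith
    have h1 : (b (t + j) ^ 2 + w (t + j) ^ 2 + m) / (b (t + j) ^ 2 + w (t + j) ^ 2 + 1) ≤
        1 - (1 - m) / S := by
      have : (b (t + j) ^ 2 + w (t + j) ^ 2 + m) / (b (t + j) ^ 2 + w (t + j) ^ 2 + 1) =
        1 - (1 - m) / (b (t + j) ^ 2 + w (t + j) ^ 2 + 1) := by field_simp; ring
      rw [this]
      have h2 : 0 ≤ 1 - m := by linarith
      gcongr
    calc _ ≤ (1 - (1 - m) / S) * ((1 - (1 - m) / S) ^ j * K) * b (t + j + 1) := by gcongr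
      _ = (1 - (1 - m) / S) ^ (j + 1) * K * b (t + (j + 1)) := by
        rw [pow_succ, add_assoc]; ring

/-- The leading component never falls below the cosine of the current angle. -/
theorem one_le_mul_main_succ (h : IterationSystem b w m) {t : ℕ} {K : ℝ} (hK : w t ≤ K * b t) :
    1 ≤ (1 + K ^ 2) * b (t + 1) ^ 2 := by
  have hs := h.sq_pos t
  have hb := h.main_pos t
  have hw := h.nonneg t
  have hsb : b t ^ 2 + w t ^ 2 ≤ (1 + K ^ 2) * b t ^ 2 := by
    have : w t ^ 2 ≤ (K * b t) ^ 2 := by gcongr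
    linarith
  have h2 : b t ^ 2 / (b t ^ 2 + w t ^ 2) ≤ b (t + 1) ^ 2 := by
    rw [h.main_step t]
    generalize b t ^ 2 + w t ^ 2 = s at *
    -- AM-GM, `½ (1 + 1/s) ≥ 1/√s`, in squared form.
    have : (1 / 2 * (1 + 1 / s) * b t) ^ 2 - b t ^ 2 / s = ((1 / 2) * (1 - 1 / s) * b t) ^ 2 := by
      field_simp; ring
    nlinarith [sq_nonneg ((1 / 2) * (1 - 1 / s) * b t)]
  calc 1 ≤ (1 + K ^ 2) * (b t ^ 2 / (b t ^ 2 + w t ^ 2)) := by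
        rw [← mul_div_assoc, one_le_div hs]; exact hsb
    _ ≤ _ := by gcongr

theorem main_succ_le (h : IterationSystem b w m) (t : ℕ) :
    b (t + 1) ≤ 1 / 2 * (b t + 1 / b t) := by
  have hb := h.main_pos t
  rw [h.main_step t]
  have : 1 / (b t ^ 2 + w t ^ 2) ≤ 1 / b t ^ 2 := by
    gcongr; nlinarith [sq_nonneg (w t)]
  calc _ ≤ 1 / 2 * (1 + 1 / b t ^ 2) * b t := by gcongr
    _ = _ := by field_simp

theorem main_le_of_lower (h : IterationSystem b w m) {q : ℝ} (hq : 0 < q) {t : ℕ}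
    (hlow : ∀ j, q ≤ b (t + j)) : ∀ j, b (t + j) ≤ b t / 2 ^ j + 1 / q
  | 0 => by simp [hq.le]
  | j + 1 => by
    have h1 := h.main_succ_le (t + j)
    have h2 := h.main_le_of_lower hq hlow j
    have h3 : 1 / b (t + j) ≤ 1 / q := one_div_le_one_div_of_le hq (hlow j)
    rw [← add_assoc]
    have : b t / 2 ^ (j + 1) = (b t / 2 ^ j) / 2 := by rw [pow_succ]; field_simp
    rw [this]
    linarith

/-- Once the angle is at most `τ`, the leading component converges to `1` geometrically. -/
theorem main_sub_one_le (h : IterationSystem b w m) {τ : ℝ} (hτ : 0 ≤ τ) (hτ2 : τ ≤ 1 / 2) {t : ℕ}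
    (hlow : ∀ j, 1 - τ ≤ b (t + j)) : ∀ j, b (t + j) - 1 ≤ max ((b t - 1) / 2 ^ j) τ
  | 0 => by simp
  | j + 1 => by
    have hb := h.main_pos (t + j)
    have h1 := h.main_succ_le (t + j)
    have h2 := h.main_sub_one_le hτ hτ2 hlow j
    have h3 := hlow j
    rw [← add_assoc]
    have e : 1 / 2 * (b (t + j) + 1 / b (t + j)) - 1 = (b (t + j) - 1) ^ 2 / (2 * b (t + j)) := by
      field_simp; ring
    have h4 : b (t + j + 1) - 1 ≤ (b (t + j) - 1) ^ 2 / (2 * b (t + j)) := by linarith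
    generalize b (t + j) = x at *
    have e2 : (b t - 1) / 2 ^ (j + 1) = ((b t - 1) / 2 ^ j) / 2 := by rw [pow_succ]; field_simp
    rcases le_total 1 x with hx | hx
    · have h5 : (x - 1) ^ 2 / (2 * x) ≤ (x - 1) / 2 := by
        rw [div_le_div_iff₀ (by positivity) (by norm_num)]
        nlinarith
      rw [e2]
      rcases le_max_iff.1 h2 with h6 | h6
      · exact le_max_of_le_left (by linarith)
      · exact le_max_of_le_right (by linarith)
    -- Here `1 - τ ≤ x ≤ 1` and `2 x ≥ 1`, so the error after the step is at most `τ² ≤ τ`.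
    · refine le_max_of_le_right (h4.trans ?_)
      rw [div_le_iff₀ (by positivity)]
      nlinarith

/-- The phases are: one step for `b ≥ q`, `n₁` steps until `b ≤ 2/q²`, `n₂` steps until the tangent
is at most `τ`, one step for `b ≥ 1 - τ`, and `n₃` steps to bring `b` down to `1 + τ`. -/
theorem converges (h : IterationSystem b w m) {q τ : ℝ} (hq : 0 < q) (hq1 : q ≤ 1)
    (hτ : 0 ≤ τ) (hτ2 : τ ≤ 1 / 2) (hcos : q ^ 2 * (b 0 ^ 2 + w 0 ^ 2) ≤ b 0 ^ 2) {n₁ n₂ n₃ : ℕ}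
    (h₁ : 1 / 2 * (b 0 + 1 / b 0) ≤ 2 ^ n₁ / q ^ 2)
    (h₂ : (1 - (1 - m) * q ^ 6 / 5) ^ n₂ / q ≤ τ) (h₃ : 2 / q ^ 2 ≤ 2 ^ n₃ * τ)
    {t : ℕ} (ht : 2 + n₁ + n₂ + n₃ ≤ t) : w t ≤ τ * b t ∧ |b t - 1| ≤ τ := by
  have hb0 := h.pos
  have hw0 := h.nonneg 0
  -- `K` is the initial tangent; the cosine bound reads `1 + K² ≤ 1/q²`.
  obtain ⟨K, hK0, hKq, hwK⟩ : ∃ K : ℝ, 0 ≤ K ∧ q ^ 2 * (1 + K ^ 2) ≤ 1 ∧ w 0 ≤ K * b 0 := by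
    refine ⟨w 0 / b 0, by positivity, ?_, by field_simp; exact le_rfl⟩
    have : q ^ 2 * (1 + (w 0 / b 0) ^ 2) = q ^ 2 * (b 0 ^ 2 + w 0 ^ 2) / b 0 ^ 2 := by field_simp
    rw [this, div_le_one (by positivity)]
    exact hcos
  have hKle : K ≤ 1 / q := by
    rw [le_div_iff₀ hq]
    have : (K * q) ^ 2 ≤ 1 ^ 2 := by nlinarith [sq_nonneg q]
    exact abs_le_of_sq_le_sq' this (by norm_num) |>.2
  have hK1 : 1 + K ^ 2 ≤ 1 / q ^ 2 := by
    rw [le_div_iff₀ (by positivity)]; linarith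
  have htan : ∀ t, w t ≤ K * b t := fun t => by simpa using h.tan_antitone hK0 hwK t
  have hlow : ∀ j, q ≤ b (1 + j) := fun j => by
    have h1 := h.one_le_mul_main_succ (htan j)
    have hb := h.main_pos (1 + j)
    rw [add_comm j 1] at h1
    have h3 : q ^ 2 ≤ b (1 + j) ^ 2 := by
      calc q ^ 2 ≤ q ^ 2 * ((1 + K ^ 2) * b (1 + j) ^ 2) := le_mul_of_one_le_right (by positivity) h1
        _ = (q ^ 2 * (1 + K ^ 2)) * b (1 + j) ^ 2 := by ring
        _ ≤ 1 * b (1 + j) ^ 2 := by gcongr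
        _ = _ := one_mul _
    exact le_of_sq_le_sq h3 hb.le
  have hq2 : 1 / q ≤ 1 / q ^ 2 := one_div_le_one_div_of_le (by positivity) (by nlinarith)
  have hup : ∀ j, b (1 + n₁ + j) ≤ 2 / q ^ 2 := fun j => by
    have h1 := h.main_le_of_lower hq hlow (n₁ + j)
    have h2 : b 1 ≤ 2 ^ n₁ / q ^ 2 := (h.main_succ_le 0).trans h₁
    have hb1 := h.main_pos 1
    have h3 : b 1 / 2 ^ (n₁ + j) ≤ 1 / q ^ 2 := by
      calc b 1 / 2 ^ (n₁ + j) ≤ b 1 / 2 ^ n₁ := by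
            gcongr
            · norm_num
            · omega
        _ ≤ (2 ^ n₁ / q ^ 2) / 2 ^ n₁ := by gcongr
        _ = _ := by field_simp
    rw [← add_assoc] at h1
    have : 2 / q ^ 2 = 1 / q ^ 2 + 1 / q ^ 2 := by ring
    linarith
  -- Since `w ≤ K b`, the sum of squares is at most `(1 + K²) b² ≤ q⁻² (2 q⁻²)²`; the extra `1` is
  -- absorbed in `q⁻⁶`.
  have hS : ∀ j, b (1 + n₁ + j) ^ 2 + w (1 + n₁ + j) ^ 2 + 1 ≤ 5 / q ^ 6 := fun j => by
    have hb := h.main_pos (1 + n₁ + j)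
    have hw := h.nonneg (1 + n₁ + j)
    have h1 : w (1 + n₁ + j) ^ 2 ≤ (K * b (1 + n₁ + j)) ^ 2 := by gcongr; exact htan _
    have h2 : b (1 + n₁ + j) ^ 2 ≤ (2 / q ^ 2) ^ 2 := by gcongr; exact hup j
    have h3 : (1 + K ^ 2) * b (1 + n₁ + j) ^ 2 ≤ 1 / q ^ 2 * (2 / q ^ 2) ^ 2 := by gcongr
    have h4 : 1 / q ^ 2 * (2 / q ^ 2) ^ 2 = 4 / q ^ 6 := by field_simp; norm_num
    have h5 : 1 ≤ 1 / q ^ 6 := by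
      rw [le_div_iff₀ (by positivity), one_mul]; exact pow_le_one₀ hq.le hq1
    have h6 : 5 / q ^ 6 = 4 / q ^ 6 + 1 / q ^ 6 := by ring
    linarith
  have hb2 : ∀ j, w (1 + n₁ + n₂ + j) ≤ τ * b (1 + n₁ + n₂ + j) := fun j => by
    refine h.tan_antitone hτ ?_ j
    have hb := h.main_pos (1 + n₁ + n₂)
    refine (h.tan_contract hK0 hS (htan _) n₂).trans ?_
    have e : (1 - m) / (5 / q ^ 6) = (1 - m) * q ^ 6 / 5 := by field_simp
    have hr : 0 ≤ 1 - (1 - m) * q ^ 6 / 5 := by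
      have := h.ratio_nonneg
      have h5 : q ^ 6 ≤ 1 := pow_le_one₀ hq.le hq1
      have h6 : 0 ≤ q ^ 6 := by positivity
      nlinarith
    rw [e]
    calc _ ≤ (1 - (1 - m) * q ^ 6 / 5) ^ n₂ * (1 / q) * b (1 + n₁ + n₂) := by gcongr
      _ = ((1 - (1 - m) * q ^ 6 / 5) ^ n₂ / q) * b (1 + n₁ + n₂) := by ring
      _ ≤ _ := by gcongr
  have hlow2 : ∀ j, 1 - τ ≤ b (2 + n₁ + n₂ + j) := fun j => by
    have h1 := h.one_le_mul_main_succ (hb2 j)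
    have e : 1 + n₁ + n₂ + j + 1 = 2 + n₁ + n₂ + j := by ring
    rw [e] at h1
    have hb := h.main_pos (2 + n₁ + n₂ + j)
    by_contra hc
    push Not at hc
    have h3 : b (2 + n₁ + n₂ + j) ^ 2 < (1 - τ) ^ 2 := by gcongr
    have h4 : (1 + τ ^ 2) * b (2 + n₁ + n₂ + j) ^ 2 < (1 + τ ^ 2) * (1 - τ) ^ 2 := by gcongr
    nlinarith [mul_nonneg hτ hτ, mul_nonneg (mul_nonneg hτ hτ) hτ]
  obtain ⟨j, rfl⟩ := Nat.exists_eq_add_of_le ht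
  constructor
  · have := hb2 (1 + n₃ + j)
    have e : 1 + n₁ + n₂ + (1 + n₃ + j) = 2 + n₁ + n₂ + n₃ + j := by ring
    rwa [e] at this
  · have h5 := h.main_sub_one_le hτ hτ2 hlow2 (n₃ + j)
    have h6 := hlow2 (n₃ + j)
    rw [← add_assoc] at h5 h6
    rw [abs_le]
    refine ⟨by linarith, h5.trans (max_le ?_ le_rfl)⟩
    have h7 := hup (1 + n₂)
    have e : 1 + n₁ + (1 + n₂) = 2 + n₁ + n₂ := by ring
    rw [e] at h7
    rw [div_le_iff₀ (by positivity)]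
    have h8 : (2 : ℝ) ^ n₃ * τ ≤ τ * 2 ^ (n₃ + j) := by
      rw [pow_add, mul_comm τ, mul_assoc]
      gcongr
      exact le_mul_of_one_le_left hτ (one_le_pow₀ (by norm_num))
    linarith

end IterationSystem

/-! ### Leading eigenpairs and distances between lines -/

section Geometry

variable {E : Type*} [NormedAddCommGroup E] [InnerProductSpace ℝ E]

theorem norm_sq_sub_proj {v : E} (hv : ‖v‖ = 1) (x : E) :
    ‖x - ⟪v, x⟫ • v‖ ^ 2 = ‖x‖ ^ 2 - ⟪v, x⟫ ^ 2 := by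
  rw [norm_sub_sq_real, norm_smul, hv, real_inner_smul_right, real_inner_comm, mul_one,
    Real.norm_eq_abs, sq_abs]
  ring

theorem inner_sub_proj {v : E} (hv : ‖v‖ = 1) (x : E) : ⟪v, x - ⟪v, x⟫ • v⟫ = 0 := by
  rw [inner_sub_right, real_inner_smul_right, real_inner_self_eq_norm_sq, hv]
  ring

theorem norm_sub_proj_le {v : E} (hv : ‖v‖ = 1) (x : E) : ‖x - ⟪v, x⟫ • v‖ ≤ ‖x‖ := by
  have := norm_sq_sub_proj hv x
  exact le_of_sq_le_sq (by nlinarith [sq_nonneg ⟪v, x⟫]) (norm_nonneg x)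

/-- A unit vector near a line is near one of the two unit vectors of the line. -/
theorem min_norm_sub_add_le {v x : E} (hv : ‖v‖ = 1) (hx : ‖x‖ = 1) {τ : ℝ}
    (h : ‖x - ⟪v, x⟫ • v‖ ≤ τ) : min ‖v - x‖ ‖v + x‖ ≤ 2 * τ := by
  have h0 := norm_sq_sub_proj hv x
  have hτ : 0 ≤ τ := (norm_nonneg _).trans h
  have h1 : ‖x - ⟪v, x⟫ • v‖ ^ 2 ≤ τ ^ 2 := by gcongr
  have hc : |⟪v, x⟫| ≤ 1 := by simpa [hv, hx] using abs_real_inner_le_norm v x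
  rw [h0, hx] at h1
  rcases abs_le.1 hc with ⟨hc1, hc2⟩
  rcases le_total 0 ⟪v, x⟫ with h2 | h2
  · refine min_le_of_left_le (le_of_sq_le_sq ?_ (by positivity))
    rw [norm_sub_sq_real, hv, hx]
    nlinarith
  · refine min_le_of_right_le (le_of_sq_le_sq ?_ (by positivity))
    rw [norm_add_sq_real, hv, hx]
    nlinarith

theorem norm_rankOne_sub_le {v x : E} (hv : ‖v‖ = 1) (hx : ‖x‖ = 1) {a b δ : ℝ} (ha : 0 ≤ a)
    (h : min ‖v - x‖ ‖v + x‖ ≤ δ) (z : E) :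
    ‖a • ⟪v, z⟫ • v - b • ⟪x, z⟫ • x‖ ≤ (|a - b| + 2 * a * δ) * ‖z‖ := by
  have main : ∀ y : E, ‖y‖ = 1 → ‖v - y‖ ≤ δ →
      ‖a • ⟪v, z⟫ • v - b • ⟪y, z⟫ • y‖ ≤ (|a - b| + 2 * a * δ) * ‖z‖ := by
    intro y hy hd
    -- Replace one factor at a time: the two copies of `v`, then the coefficient.
    have e : a • ⟪v, z⟫ • v - b • ⟪y, z⟫ • y =
        (a * ⟪v - y, z⟫) • v + (a * ⟪y, z⟫) • (v - y) + ((a - b) * ⟪y, z⟫) • y := by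
      rw [inner_sub_left]; module
    have hδ : 0 ≤ δ := (norm_nonneg _).trans hd
    have i1 : |⟪v - y, z⟫| ≤ δ * ‖z‖ := (abs_real_inner_le_norm _ _).trans (by gcongr)
    have i2 : |⟪y, z⟫| ≤ ‖z‖ := by simpa [hy] using abs_real_inner_le_norm y z
    rw [e]
    refine (norm_add₃_le).trans ?_
    simp only [norm_smul, hv, hy, mul_one, Real.norm_eq_abs, abs_mul, abs_of_nonneg ha]
    calc _ ≤ a * (δ * ‖z‖) + a * ‖z‖ * δ + |a - b| * ‖z‖ := by gcongr
      _ = _ := by ring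
  rcases min_le_iff.1 h with h1 | h1
  · exact main x hx h1
  · have := main (-x) (by simpa) (by simpa using h1)
    simpa using this

/-- `v` is a unit eigenvector of the symmetric operator `T` for the eigenvalue `lam`, and `T` has
norm at most `mu < lam` on the orthogonal complement of `v`. -/
structure LeadingPair (T : E →ₗ[ℝ] E) (lam mu : ℝ) (v : E) : Prop where
  symm : T.IsSymmetric
  unit : ‖v‖ = 1
  map_eq : T v = lam • v
  nonneg : 0 ≤ mu
  lt : mu < lam
  perp : ∀ y, ⟪v, y⟫ = 0 → ‖T y‖ ≤ mu * ‖y‖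

namespace LeadingPair

variable {T : E →ₗ[ℝ] E} {lam mu : ℝ} {v : E}

theorem pos (h : LeadingPair T lam mu v) : 0 < lam := h.nonneg.trans_lt h.lt

theorem ne_zero (h : LeadingPair T lam mu v) : v ≠ 0 := by
  have := h.unit
  rintro rfl
  simp at this

theorem inner_map (h : LeadingPair T lam mu v) (x : E) : ⟪v, T x⟫ = lam * ⟪v, x⟫ := by
  rw [← h.symm v x, h.map_eq, real_inner_smul_left]

theorem map_sub_proj (h : LeadingPair T lam mu v) (x : E) :
    T (x - ⟪v, x⟫ • v) = T x - ⟪v, T x⟫ • v := by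
  rw [map_sub, map_smul, h.map_eq, h.inner_map, smul_smul, mul_comm]

theorem eigenspace_eq (h : LeadingPair T lam mu v) :
    Module.End.eigenspace T lam = Submodule.span ℝ {v} := by
  ext y
  rw [Module.End.mem_eigenspace_iff, Submodule.mem_span_singleton]
  constructor
  · intro hy
    refine ⟨⟪v, y⟫, ?_⟩
    have h1 := h.perp _ (inner_sub_proj h.unit y)
    rw [h.map_sub_proj, h.inner_map, hy, mul_smul, ← smul_sub, norm_smul, Real.norm_eq_abs,
      abs_of_pos h.pos] at h1
    have h2 : ‖y - ⟪v, y⟫ • v‖ = 0 := by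
      have := h.lt
      nlinarith [norm_nonneg (y - ⟪v, y⟫ • v)]
    exact (sub_eq_zero.1 (norm_eq_zero.1 h2)).symm
  · rintro ⟨c, rfl⟩
    rw [map_smul, h.map_eq, smul_comm]

theorem isGreatest (h : LeadingPair T lam mu v) :
    IsGreatest {μ : ℝ | Module.End.HasEigenvalue T μ} lam := by
  constructor
  · exact Module.End.hasEigenvalue_of_hasEigenvector
      ⟨Module.End.mem_eigenspace_iff.2 h.map_eq, h.ne_zero⟩
  · intro μ hμ
    obtain ⟨y, hy, hy0⟩ := hμ.exists_hasEigenvector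
    rw [Module.End.mem_eigenspace_iff] at hy
    by_contra hc
    push Not at hc
    have h1 := h.inner_map y
    rw [hy, real_inner_smul_right] at h1
    have h2 : ⟪v, y⟫ = 0 := by
      have : (μ - lam) * ⟪v, y⟫ = 0 := by linarith
      rcases mul_eq_zero.1 this with h3 | h3
      · linarith
      · exact h3
    have h3 := h.perp y h2
    rw [hy, norm_smul, Real.norm_eq_abs] at h3
    have h4 := norm_pos_iff.2 hy0
    have h5 := le_of_mul_le_mul_right h3 h4
    have := le_abs_self μ
    have := h.lt
    linarith

end LeadingPair

end Geometry

/-! ### Gradient descent on one matrix -/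

theorem topEigenvalue_eq {n : ℕ} {A : Matrix (Fin n) (Fin n) ℝ} {lam mu : ℝ} {v : Vec n}
    (h : LeadingPair A.toEuclideanLin lam mu v) : topEigenvalue A = lam :=
  h.isGreatest.csSup_eq

theorem topCos_eq {n : ℕ} {A : Matrix (Fin n) (Fin n) ℝ} {lam mu : ℝ} {v : Vec n}
    (h : LeadingPair A.toEuclideanLin lam mu v) (x : Vec n) : topCos A x = |⟪v, x⟫| / ‖x‖ := by
  have key : ∀ S : Submodule ℝ (Vec n), S = Submodule.span ℝ {v} →
      ‖S.starProjection x‖ = |⟪v, x⟫| := by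
    rintro S rfl
    rw [Submodule.starProjection_unit_singleton ℝ h.unit, norm_smul, h.unit, mul_one,
      Real.norm_eq_abs]
  rw [topCos, key _ (by rw [topEigenvalue_eq h, h.eigenspace_eq])]

/-- The step averages `x` with a scaled power step. It needs no `x ≠ 0`: both sides vanish at `0` by
the convention `1/0 = 0`. -/
theorem gradStep_eq {n : ℕ} {A : Matrix (Fin n) (Fin n) ℝ} (hA : A.IsSymm) (x : Vec n) :
    gradStep A x = (1 / 2 : ℝ) • (x + (1 / ‖x‖ ^ 2) • A.toEuclideanLin x) := by
  rw [gradStep, gradient_rankOneLoss A hA]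
  rcases eq_or_ne x 0 with rfl | hx
  · simp
  · have : ‖x‖ ≠ 0 := norm_ne_zero_iff.2 hx
    rw [smul_sub, smul_smul, smul_add, smul_smul]
    have e1 : 1 / 2 / ‖x‖ ^ 2 * ‖x‖ ^ 2 = 1 / 2 := by field_simp
    have e2 : (1 / 2 : ℝ) / ‖x‖ ^ 2 = 1 / 2 * (1 / ‖x‖ ^ 2) := by field_simp
    rw [e1, e2]
    module

theorem gdIterate_succ {n : ℕ} (A : Matrix (Fin n) (Fin n) ℝ) (g : Vec n) (t : ℕ) :
    gdIterate A g (t + 1) = gradStep A (gdIterate A g t) :=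
  Function.iterate_succ_apply' _ _ _

theorem iterationSystem_gdIterate {n : ℕ} {A : Matrix (Fin n) (Fin n) ℝ} (hA : A.IsSymm)
    {lam mu : ℝ} {v : Vec n} (h : LeadingPair A.toEuclideanLin lam mu v) {g : Vec n}
    (hg : ⟪v, initPoint A g⟫ ≠ 0) :
    IterationSystem (fun t => |⟪v, gdIterate A g t⟫| / √lam)
      (fun t => ‖gdIterate A g t - ⟪v, gdIterate A g t⟫ • v‖ / √lam) (mu / lam) := by
  have hl := h.pos
  have hsq : √lam ^ 2 = lam := Real.sq_sqrt hl.le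
  have hs : 0 < √lam := Real.sqrt_pos.2 hl
  have hnorm : ∀ t, (|⟪v, gdIterate A g t⟫| / √lam) ^ 2 +
      (‖gdIterate A g t - ⟪v, gdIterate A g t⟫ • v‖ / √lam) ^ 2 = ‖gdIterate A g t‖ ^ 2 / lam := by
    intro t
    rw [div_pow, div_pow, hsq, norm_sq_sub_proj h.unit, sq_abs]
    ring
  have hi : ∀ t, ⟪v, gdIterate A g (t + 1)⟫ =
      1 / 2 * (1 + lam / ‖gdIterate A g t‖ ^ 2) * ⟪v, gdIterate A g t⟫ := by
    intro t
    rw [gdIterate_succ, gradStep_eq hA, real_inner_smul_right, inner_add_right,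
      real_inner_smul_right, h.inner_map]
    ring
  have hinv : ∀ t c, c / lam / (‖gdIterate A g t‖ ^ 2 / lam) = c / ‖gdIterate A g t‖ ^ 2 := by
    intro t c
    field_simp
  constructor
  · have : 0 < |⟪v, initPoint A g⟫| := abs_pos.2 hg
    exact div_pos this hs
  · intro t; positivity
  · exact div_nonneg h.nonneg hl.le
  · rw [div_le_one hl]; exact h.lt.le
  · intro t
    have e : 1 / (‖gdIterate A g t‖ ^ 2 / lam) = lam / ‖gdIterate A g t‖ ^ 2 := by
      rw [one_div_div]
    simp only [hnorm]
    rw [hi, abs_mul, abs_of_nonneg (by positivity), e]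
    ring
  · intro t
    simp only [hnorm]
    rw [hinv]
    have e : gdIterate A g (t + 1) - ⟪v, gdIterate A g (t + 1)⟫ • v = (1 / 2 : ℝ) •
        ((gdIterate A g t - ⟪v, gdIterate A g t⟫ • v) + (1 / ‖gdIterate A g t‖ ^ 2) •
          A.toEuclideanLin (gdIterate A g t - ⟪v, gdIterate A g t⟫ • v)) := by
      rw [h.map_sub_proj, h.inner_map, hi, gdIterate_succ, gradStep_eq hA]
      module
    rw [e, norm_smul]
    have hp := h.perp _ (inner_sub_proj h.unit (gdIterate A g t))
    have hmu := h.nonneg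
    set y := gdIterate A g t - ⟪v, gdIterate A g t⟫ • v
    set s := ‖gdIterate A g t‖ ^ 2
    have hs0 : 0 ≤ s := by positivity
    have h1 : ‖y + (1 / s) • A.toEuclideanLin y‖ ≤ (1 + mu / s) * ‖y‖ := by
      refine (norm_add_le _ _).trans ?_
      rw [norm_smul, Real.norm_eq_abs, abs_of_nonneg (by positivity)]
      calc ‖y‖ + 1 / s * ‖A.toEuclideanLin y‖ ≤ ‖y‖ + 1 / s * (mu * ‖y‖) := by gcongr
        _ = _ := by ring
    rw [mul_div_assoc', Real.norm_eq_abs, abs_of_nonneg (by norm_num : (0 : ℝ) ≤ 1 / 2), mul_assoc]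
    exact div_le_div_of_nonneg_right (mul_le_mul_of_nonneg_left h1 (by norm_num)) hs.le

/-- The iteration count that suffices for one stage. -/
theorem exists_iteration_counts {q m Γ L L' lam : ℝ} (hq : 0 < q) (hq1 : q ≤ 1) (hΓ : 1 ≤ Γ)
    (hm0 : 0 ≤ m) (hm : 1 / (4 * Γ) ≤ 1 - m) (hL : 1 / 2 ≤ L) (hL' : 1 ≤ L')
    (hlog : Real.log 2 ≤ L)
    (hlam : lam + 1 / lam ≤ Real.exp L') (hlam0 : 0 < lam) {b : ℝ} (hb : q ^ 2 * √lam ≤ b)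
    (hb' : b ≤ √lam / q) {t : ℕ} (ht : 600 / q ^ 7 * (Γ * L) + 5 * L' ≤ t) :
    ∃ n₁ n₂ n₃ : ℕ, 1 / 2 * (b + 1 / b) ≤ 2 ^ n₁ / q ^ 2 ∧
      (1 - (1 - m) * q ^ 6 / 5) ^ n₂ / q ≤ Real.exp (-(20 * L)) ∧
      2 / q ^ 2 ≤ 2 ^ n₃ * Real.exp (-(20 * L)) ∧ 2 + n₁ + n₂ + n₃ ≤ t := by
  -- The factor `2` suffices because `log 2 > 1/2`.
  have two_pow : ∀ (x : ℝ) (n : ℕ), 2 * x ≤ n → Real.exp x ≤ 2 ^ n := by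
    intro x n hx
    have h2 := Real.log_two_gt_d9
    rw [← Real.exp_log (show (0 : ℝ) < 2 ^ n by positivity), Real.exp_le_exp, Real.log_pow]
    have : (0 : ℝ) ≤ n := by positivity
    nlinarith
  have hqi : 1 ≤ 1 / q := by rw [le_div_iff₀ hq]; linarith
  -- Reaching angle `τ` from tangent `1/q` costs an additional `log (1/q)`, bounded here by a
  -- multiple of `L/q`; this raises the `q⁻⁶` of the contraction rate to `q⁻⁷`.
  have hlogq : Real.log (1 / q) ≤ 2 * L / q := by
    have h1 := Real.log_le_sub_one_of_pos (show 0 < 1 / q by positivity)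
    have h2 : 1 / q ≤ 2 * L / q := by gcongr; linarith
    linarith
  have hs : 0 < √lam := Real.sqrt_pos.2 hlam0
  have hsq : √lam ^ 2 = lam := Real.sq_sqrt hlam0.le
  have hb0 : 0 < b := lt_of_lt_of_le (by positivity) hb
  have hq7 : 1 ≤ 1 / q ^ 7 := by
    rw [le_div_iff₀ (by positivity), one_mul]; exact pow_le_one₀ hq.le hq1
  have hq17 : 1 / q ≤ 1 / q ^ 7 :=
    one_div_le_one_div_of_le (by positivity) (pow_le_of_le_one hq.le hq1 (by norm_num))
  have hΓL : L ≤ Γ * L := le_mul_of_one_le_left (by linarith) hΓ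
  have hW : 1 / 2 ≤ 1 / q ^ 7 * (Γ * L) := by nlinarith
  -- The rate is at least `q⁶/(20 Γ)`, so `440 ΓL/q⁷` steps yield exponent `22 L/q ≥ 20 L + log
  -- (1/q)`. The slack between `440 + 50` and `600` pays for the fixed steps and the ceilings.
  refine ⟨⌈2 * L'⌉₊, ⌈440 / q ^ 7 * (Γ * L)⌉₊, ⌈50 / q ^ 7 * (Γ * L)⌉₊, ?_, ?_, ?_, ?_⟩
  · have h1 := (two_pow L' _ (Nat.le_ceil _))
    have h2 : 1 / b ≤ 1 / (q ^ 2 * √lam) := one_div_le_one_div_of_le (by positivity) hb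
    have h3 : √lam ≤ (1 + lam) / 2 := by nlinarith [sq_nonneg (√lam - 1)]
    have h4 : 1 / √lam ≤ (1 + 1 / lam) / 2 := by
      have : (1 / √lam) ^ 2 = 1 / lam := by rw [div_pow, hsq, one_pow]
      nlinarith [sq_nonneg (1 / √lam - 1)]
    have h5 : 2 ≤ lam + 1 / lam := by
      have e : lam + 1 / lam - 2 = (lam - 1) ^ 2 / lam := by field_simp; ring
      have : 0 ≤ (lam - 1) ^ 2 / lam := by positivity
      linarith
    have h6 : √lam / q ≤ √lam / q ^ 2 := by
      gcongr
      nlinarith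
    calc 1 / 2 * (b + 1 / b) ≤ 1 / 2 * (√lam / q ^ 2 + 1 / (q ^ 2 * √lam)) := by
          gcongr; exact hb'.trans h6
      _ = (1 / 2 * (√lam + 1 / √lam)) / q ^ 2 := by field_simp
      _ ≤ _ := by gcongr; linarith
  · have hx0 : 1 / (20 * Γ) * q ^ 6 ≤ (1 - m) * q ^ 6 / 5 := by
      have : 1 / (20 * Γ) = 1 / (4 * Γ) / 5 := by field_simp; norm_num
      rw [this, mul_comm_div, mul_div_assoc', mul_comm (1 / (4 * Γ)), mul_div_assoc, mul_div_assoc,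
        mul_comm (1 - m)]
      have : 1 / (4 * Γ) / 5 ≤ (1 - m) / 5 := by gcongr
      calc _ = q ^ 6 * (1 / (4 * Γ) / 5) := by ring
        _ ≤ q ^ 6 * ((1 - m) / 5) := by gcongr
        _ = _ := by ring
    set x := (1 - m) * q ^ 6 / 5
    set N := ⌈440 / q ^ 7 * (Γ * L)⌉₊
    have hN : 440 / q ^ 7 * (Γ * L) ≤ N := Nat.le_ceil _
    have hx1 : 0 ≤ 1 - x := by
      have h5 : q ^ 6 ≤ 1 := pow_le_one₀ hq.le hq1
      have h6 : 0 ≤ q ^ 6 := by positivity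
      have : x ≤ 1 / 5 := by
        have : (1 - m) * q ^ 6 ≤ 1 := by nlinarith
        simp only [x]; linarith
      linarith
    have h1 : (1 - x) ^ N ≤ Real.exp (-(N * x)) := by
      calc (1 - x) ^ N ≤ Real.exp (-x) ^ N := by
            gcongr; exact Real.one_sub_le_exp_neg x
        _ = _ := by rw [← Real.exp_nat_mul]; ring_nf
    have h2 : 22 * L / q ≤ N * x := by
      calc 22 * L / q = (440 / q ^ 7 * (Γ * L)) * (1 / (20 * Γ) * q ^ 6) := by
            field_simp; norm_num
        _ ≤ N * x := by gcongr
    have h3 : 20 * L + Real.log (1 / q) ≤ N * x := by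
      have : 20 * L ≤ 20 * L / q := by rw [le_div_iff₀ hq]; nlinarith
      have : 22 * L / q = 20 * L / q + 2 * L / q := by ring
      linarith
    calc (1 - x) ^ N / q ≤ Real.exp (-(N * x)) * (1 / q) := by
          rw [div_eq_mul_one_div]; gcongr
      _ = Real.exp (-(N * x) + Real.log (1 / q)) := by
          rw [Real.exp_add, Real.exp_log (by positivity)]
      _ ≤ _ := by rw [Real.exp_le_exp]; linarith
  · have h1 := two_pow (25 * L / q) ⌈50 / q ^ 7 * (Γ * L)⌉₊ (by
      refine le_trans ?_ (Nat.le_ceil _)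
      calc 2 * (25 * L / q) = 50 * (1 / q * L) := by ring
        _ ≤ 50 * (1 / q ^ 7 * (Γ * L)) := by gcongr
        _ = _ := by ring)
    have h2 : 2 / q ^ 2 ≤ Real.exp (25 * L / q) * Real.exp (-(20 * L)) := by
      rw [← Real.exp_add]
      have e : 2 / q ^ 2 = Real.exp (Real.log 2 + 2 * Real.log (1 / q)) := by
        rw [two_mul, Real.exp_add, Real.exp_add, Real.exp_log (by norm_num),
          Real.exp_log (by positivity)]
        field_simp
      rw [e, Real.exp_le_exp]
      have : L ≤ L / q := by rw [le_div_iff₀ hq]; nlinarith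
      have e2 : 25 * L / q = 25 * (L / q) := by ring
      have e3 : 2 * L / q = 2 * (L / q) := by ring
      linarith
    refine h2.trans ?_
    gcongr
  · have c1 := Nat.ceil_lt_add_one (show 0 ≤ 2 * L' by linarith)
    have c2 := Nat.ceil_lt_add_one (show 0 ≤ 440 / q ^ 7 * (Γ * L) by positivity)
    have c3 := Nat.ceil_lt_add_one (show 0 ≤ 50 / q ^ 7 * (Γ * L) by positivity)
    have e1 : 440 / q ^ 7 * (Γ * L) = 440 * (1 / q ^ 7 * (Γ * L)) := by ring
    have e2 : 50 / q ^ 7 * (Γ * L) = 50 * (1 / q ^ 7 * (Γ * L)) := by ring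
    have e3 : 600 / q ^ 7 * (Γ * L) = 600 * (1 / q ^ 7 * (Γ * L)) := by ring
    rw [e1] at c2
    rw [e2] at c3
    rw [e3] at ht
    rw [e1, e2]
    have : ((2 + ⌈2 * L'⌉₊ + ⌈440 * (1 / q ^ 7 * (Γ * L))⌉₊ +
        ⌈50 * (1 / q ^ 7 * (Γ * L))⌉₊ : ℕ) : ℝ) ≤ t := by
      push_cast
      linarith
    exact_mod_cast this

theorem initQuality_le_one {n : ℕ} (A : Matrix (Fin n) (Fin n) ℝ) (x : Vec n) :
    initQuality A x ≤ 1 := by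
  unfold initQuality
  rcases le_total (‖x‖ / topEigenvalue A) 1 with h | h
  · exact (min_le_right _ _).trans ((min_le_left _ _).trans h)
  · refine (min_le_right _ _).trans ((min_le_right _ _).trans ?_)
    rw [← inv_div]
    exact inv_le_one_of_one_le₀ h

theorem initQuality_pos {n : ℕ} {A : Matrix (Fin n) (Fin n) ℝ} {lam mu : ℝ} {v : Vec n}
    (h : LeadingPair A.toEuclideanLin lam mu v) {g : Vec n} (hg : ⟪v, g⟫ ≠ 0) :
    0 < initQuality A (initPoint A g) := by
  have hl := h.pos
  have h1 : ⟪v, initPoint A g⟫ ≠ 0 := by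
    rw [initPoint, h.inner_map]
    exact mul_ne_zero hl.ne' hg
  have h2 : 0 < ‖initPoint A g‖ := by
    rw [norm_pos_iff]
    rintro h0
    rw [h0, inner_zero_right] at h1
    exact h1 rfl
  have h3 := abs_pos.2 h1
  unfold initQuality
  rw [topCos_eq h, topEigenvalue_eq h]
  exact lt_min (by positivity) (lt_min (by positivity) (by positivity))

theorem exp_neg_mul_le_half {L : ℝ} (hL : Real.log 2 ≤ L) : Real.exp (-(20 * L)) ≤ 1 / 2 := by
  have h1 := Real.log_two_gt_d9
  have h2 : Real.exp (-(20 * L)) ≤ Real.exp (-Real.log 2) := by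
    rw [Real.exp_le_exp]; linarith
  rwa [Real.exp_neg (Real.log 2), Real.exp_log (by norm_num), ← one_div] at h2

/-- Convergence of gradient descent on a matrix with a leading eigenpair. -/
theorem gdIterate_converges {n : ℕ} {A : Matrix (Fin n) (Fin n) ℝ} (hA : A.IsSymm)
    {lam mu : ℝ} {v : Vec n} (h : LeadingPair A.toEuclideanLin lam mu v) {g : Vec n}
    (hq : 0 < initQuality A (initPoint A g)) {Γ L L' : ℝ} (hΓ : 1 ≤ Γ)
    (hm : 1 / (4 * Γ) ≤ 1 - mu / lam) (hL : Real.log 2 ≤ L) (hL' : 1 ≤ L')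
    (hlam : lam + 1 / lam ≤ Real.exp L') {t : ℕ}
    (ht : 600 / initQuality A (initPoint A g) ^ 7 * (Γ * L) + 5 * L' ≤ t) :
    0 < |⟪v, gdIterate A g t⟫| ∧
      ‖gdIterate A g t - ⟪v, gdIterate A g t⟫ • v‖ ≤
        Real.exp (-(20 * L)) * |⟪v, gdIterate A g t⟫| ∧
      abs (|⟪v, gdIterate A g t⟫| / √lam - 1) ≤ Real.exp (-(20 * L)) := by
  have hl := h.pos
  have hs : 0 < √lam := Real.sqrt_pos.2 hl
  have hsq : √lam ^ 2 = lam := Real.sq_sqrt hl.le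
  have hL2 : 1 / 2 ≤ L := by linarith [Real.log_two_gt_d9]
  have hq1 := initQuality_le_one A (initPoint A g)
  set q := initQuality A (initPoint A g) with hqdef
  have hqc : q ≤ |⟪v, initPoint A g⟫| / ‖initPoint A g‖ := by
    rw [← topCos_eq h]; exact min_le_left _ _
  have hqn : q ≤ ‖initPoint A g‖ / lam := by
    rw [← topEigenvalue_eq h]; exact (min_le_right _ _).trans (min_le_left _ _)
  have hqn' : q ≤ lam / ‖initPoint A g‖ := by
    rw [← topEigenvalue_eq h]; exact (min_le_right _ _).trans (min_le_right _ _)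
  have hx : 0 < ‖initPoint A g‖ := by
    rcases (norm_nonneg (initPoint A g)).eq_or_lt with h0 | h0
    · rw [← h0] at hqn; simp at hqn; linarith
    · exact h0
  rw [le_div_iff₀ hx] at hqc hqn'
  rw [le_div_iff₀ hl] at hqn
  have hv0 : 0 < |⟪v, initPoint A g⟫| := lt_of_lt_of_le (by positivity) hqc
  have sys := iterationSystem_gdIterate hA h (g := g) (abs_pos.1 hv0)
  have hcs : |⟪v, initPoint A g⟫| ≤ ‖initPoint A g‖ := by
    simpa [h.unit] using abs_real_inner_le_norm v (initPoint A g)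
  have e0 : gdIterate A g 0 = initPoint A g := rfl
  have hb : q ^ 2 * √lam ≤ |⟪v, gdIterate A g 0⟫| / √lam := by
    rw [e0, le_div_iff₀ hs, mul_assoc, ← sq, hsq]
    nlinarith
  have hb' : |⟪v, gdIterate A g 0⟫| / √lam ≤ √lam / q := by
    rw [e0, div_le_div_iff₀ hs hq, ← sq, hsq]
    nlinarith
  obtain ⟨n₁, n₂, n₃, h₁, h₂, h₃, h₄⟩ := exists_iteration_counts hq hq1 hΓ sys.ratio_nonneg hm
    hL2 hL' hL hlam hl hb hb' ht
  have hτ := exp_neg_mul_le_half hL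
  have hcos : q ^ 2 * ((|⟪v, gdIterate A g 0⟫| / √lam) ^ 2 +
      (‖gdIterate A g 0 - ⟪v, gdIterate A g 0⟫ • v‖ / √lam) ^ 2) ≤
      (|⟪v, gdIterate A g 0⟫| / √lam) ^ 2 := by
    rw [div_pow, div_pow, norm_sq_sub_proj h.unit, sq_abs, hsq, ← add_div, mul_div_assoc']
    gcongr
    rw [e0, add_sub_cancel, ← mul_pow, ← sq_abs ⟪v, initPoint A g⟫]
    gcongr
  have := sys.converges hq hq1 (Real.exp_pos _).le hτ hcos h₁ h₂ h₃ h₄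
  refine ⟨?_, ?_, this.2⟩
  · have := sys.main_pos t
    by_contra hc
    have h0 : |⟪v, gdIterate A g t⟫| = 0 := le_antisymm (not_lt.1 hc) (abs_nonneg _)
    simp [h0] at this
  · have := this.1
    rw [mul_div_assoc'] at this
    exact (div_le_div_iff_of_pos_right hs).1 this

/-- What one stage returns: a unit vector near the leading eigenvector and a value near the
leading eigenvalue. -/
structure StageOutput {n : ℕ} (A : Matrix (Fin n) (Fin n) ℝ) (lam τ : ℝ) (v : Vec n) (s : ℝ)
    (x : Vec n) : Prop where
  unit : ‖x‖ = 1
  angle : ‖x - ⟪v, x⟫ • v‖ ≤ τ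
  value : |lam - s| ≤ 4 * τ * lam

theorem stageOutput {n : ℕ} {A : Matrix (Fin n) (Fin n) ℝ} (hA : A.IsSymm)
    {lam mu : ℝ} {v : Vec n} (h : LeadingPair A.toEuclideanLin lam mu v) {g : Vec n}
    (hq : 0 < initQuality A (initPoint A g)) {Γ L L' : ℝ} (hΓ : 1 ≤ Γ)
    (hm : 1 / (4 * Γ) ≤ 1 - mu / lam) (hL : Real.log 2 ≤ L) (hL' : 1 ≤ L')
    (hlam : lam + 1 / lam ≤ Real.exp L') {t : ℕ}
    (ht : 600 / initQuality A (initPoint A g) ^ 7 * (Γ * L) + 5 * L' ≤ t) :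
    StageOutput A lam (Real.exp (-(20 * L))) v (estValue A g t) (estVector A g t) := by
  obtain ⟨h0, h1, h2⟩ := gdIterate_converges hA h hq hΓ hm hL hL' hlam ht
  have hτ := exp_neg_mul_le_half hL
  have hτ0 : 0 ≤ Real.exp (-(20 * L)) := (Real.exp_pos _).le
  set τ := Real.exp (-(20 * L))
  unfold estValue estVector
  set x := gdIterate A g t
  have hl := h.pos
  have hs : 0 < √lam := Real.sqrt_pos.2 hl
  have hsq : √lam ^ 2 = lam := Real.sq_sqrt hl.le
  have hcs : |⟪v, x⟫| ≤ ‖x‖ := by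
    simpa [h.unit] using abs_real_inner_le_norm v x
  have hx : 0 < ‖x‖ := h0.trans_le hcs
  refine ⟨?_, ?_, ?_⟩
  · rw [norm_smul, norm_inv, norm_norm, inv_mul_cancel₀ hx.ne']
  · rw [real_inner_smul_right, mul_smul, ← smul_sub, norm_smul, norm_inv, norm_norm,
      inv_mul_le_iff₀ hx, mul_comm]
    exact h1.trans (by gcongr)
  · have e := norm_sq_sub_proj h.unit x
    have h3 : ‖x - ⟪v, x⟫ • v‖ ^ 2 ≤ (τ * |⟪v, x⟫|) ^ 2 := by gcongr
    rw [← sq_abs ⟪v, x⟫] at e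
    obtain ⟨β, hβ⟩ : ∃ β, |⟪v, x⟫| = β * √lam := ⟨|⟪v, x⟫| / √lam, by field_simp⟩
    rw [hβ, mul_div_cancel_right₀ _ hs.ne', abs_le] at h2
    rw [hβ] at h3 e
    rw [mul_pow, hsq] at e
    rw [mul_pow, mul_pow, hsq] at h3
    have hp : 0 ≤ ‖x - ⟪v, x⟫ • v‖ ^ 2 := by positivity
    have e2 : ‖x‖ ^ 2 = ‖x - ⟪v, x⟫ • v‖ ^ 2 + β ^ 2 * lam := by linarith
    have b1 : β ^ 2 ≤ (1 + τ) ^ 2 := by nlinarith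
    have b2 : (1 - τ) ^ 2 ≤ β ^ 2 := by nlinarith
    -- After division by `λ`, the squared norm is at most `(1 + τ²) β²` with `|β - 1| ≤ τ ≤ 1/2`.
    have b3 : τ ^ 2 * β ^ 2 + β ^ 2 ≤ 1 + 4 * τ := by
      calc τ ^ 2 * β ^ 2 + β ^ 2 = (1 + τ ^ 2) * β ^ 2 := by ring
        _ ≤ (1 + τ ^ 2) * (1 + τ) ^ 2 := by gcongr
        _ ≤ 1 + 4 * τ := by nlinarith [mul_nonneg hτ0 hτ0, mul_nonneg (mul_nonneg hτ0 hτ0) hτ0]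
    have b4 : 1 - 4 * τ ≤ β ^ 2 := by nlinarith
    rw [abs_le, e2]
    constructor
    · nlinarith
    · nlinarith

namespace StageOutput

variable {n : ℕ} {A : Matrix (Fin n) (Fin n) ℝ} {lam mu τ s : ℝ} {v x : Vec n}

theorem near (o : StageOutput A lam τ v s x) (h : LeadingPair A.toEuclideanLin lam mu v) :
    min ‖v - x‖ ‖v + x‖ ≤ 2 * τ :=
  min_norm_sub_add_le h.unit o.unit o.angle

theorem rankOne_near (o : StageOutput A lam τ v s x) (h : LeadingPair A.toEuclideanLin lam mu v)
    (z : Vec n) : ‖lam • ⟪v, z⟫ • v - s • ⟪x, z⟫ • x‖ ≤ 8 * τ * lam * ‖z‖ := by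
  refine (norm_rankOne_sub_le h.unit o.unit h.pos.le (o.near h) z).trans ?_
  have := o.value
  gcongr
  linarith

theorem residual (o : StageOutput A lam τ v s x) (h : LeadingPair A.toEuclideanLin lam mu v) :
    ‖A.toEuclideanLin x - lam • x‖ ≤ 2 * τ * lam := by
  have e : A.toEuclideanLin x - lam • x =
      A.toEuclideanLin (x - ⟪v, x⟫ • v) - lam • (x - ⟪v, x⟫ • v) := by
    rw [h.map_sub_proj, h.inner_map]
    module
  have hl := h.pos
  have hmu := h.lt
  have := o.angle
  have hp := h.perp _ (inner_sub_proj h.unit x)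
  rw [e]
  refine (norm_sub_le _ _).trans ?_
  rw [norm_smul, Real.norm_eq_abs, abs_of_pos hl]
  have h0 := norm_nonneg (x - ⟪v, x⟫ • v)
  nlinarith

end StageOutput

/-! ### Perturbation of symmetric operators -/

section Perturbation

variable {E : Type*} [NormedAddCommGroup E] [InnerProductSpace ℝ E] {ι : Type*} [Fintype ι]

theorem inner_basis_map (b : OrthonormalBasis ι ℝ E) {D : E →ₗ[ℝ] E} {s : ι → ℝ}
    (hD : ∀ j, D (b j) = s j • b j) (x : E) (j : ι) : ⟪b j, D x⟫ = s j * ⟪b j, x⟫ := by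
  classical
  conv_lhs => rw [← b.sum_repr' x]
  rw [map_sum, inner_sum, Finset.sum_eq_single j]
  · rw [map_smul, hD, real_inner_smul_right, real_inner_smul_right, real_inner_self_eq_norm_sq,
      b.norm_eq_one]
    ring
  · intro i _ hi
    rw [map_smul, hD, real_inner_smul_right, real_inner_smul_right,
      b.inner_eq_zero hi.symm]
    ring
  · simp

theorem norm_sq_basis (b : OrthonormalBasis ι ℝ E) (x : E) : ‖x‖ ^ 2 = ∑ j, ⟪b j, x⟫ ^ 2 :=
  (b.sum_sq_inner_right x).symm

theorem quadratic_basis (b : OrthonormalBasis ι ℝ E) {D : E →ₗ[ℝ] E} {s : ι → ℝ}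
    (hD : ∀ j, D (b j) = s j • b j) (x : E) : ⟪D x, x⟫ = ∑ j, s j * ⟪b j, x⟫ ^ 2 := by
  rw [← b.sum_inner_mul_inner (D x) x]
  refine Finset.sum_congr rfl fun j _ => ?_
  rw [real_inner_comm, inner_basis_map b hD]
  ring

theorem quadratic_le (b : OrthonormalBasis ι ℝ E) {D : E →ₗ[ℝ] E} {s : ι → ℝ}
    (hD : ∀ j, D (b j) = s j • b j) {c : ℝ} (hs : ∀ j, s j ≤ c) (x : E) :
    ⟪D x, x⟫ ≤ c * ‖x‖ ^ 2 := by
  rw [quadratic_basis b hD, norm_sq_basis b, Finset.mul_sum]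
  exact Finset.sum_le_sum fun j _ => mul_le_mul_of_nonneg_right (hs j) (sq_nonneg _)

theorem norm_map_le (b : OrthonormalBasis ι ℝ E) {D : E →ₗ[ℝ] E} {s : ι → ℝ}
    (hD : ∀ j, D (b j) = s j • b j) {l : ι} {c : ℝ} (hc : 0 ≤ c) (hsl : 0 ≤ s l)
    (hs : ∀ j, j ≠ l → |s j| ≤ c) (x : E) : ‖D x‖ ≤ s l * |⟪b l, x⟫| + c * ‖x‖ := by
  have h1 : ‖D (x - ⟪b l, x⟫ • b l)‖ ≤ c * ‖x - ⟪b l, x⟫ • b l‖ := by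
    refine le_of_sq_le_sq ?_ (by positivity)
    rw [mul_pow, norm_sq_basis b, norm_sq_basis b, Finset.mul_sum]
    refine Finset.sum_le_sum fun j _ => ?_
    rw [inner_basis_map b hD]
    rcases eq_or_ne j l with rfl | hj
    · rw [inner_sub_proj (b.norm_eq_one j)]; simp
    · rw [mul_pow, ← sq_abs (s j)]
      gcongr
      exact hs j hj
  have h2 : D x = (s l * ⟪b l, x⟫) • b l + D (x - ⟪b l, x⟫ • b l) := by
    rw [map_sub, map_smul, hD]; module
  rw [h2]
  refine (norm_add_le _ _).trans ?_
  rw [norm_smul, b.norm_eq_one, mul_one, Real.norm_eq_abs, abs_mul, abs_of_nonneg hsl]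
  have := norm_sub_proj_le (b.norm_eq_one l) x
  gcongr
  exact h1.trans (by gcongr)

/-- An approximate eigenvector, for an approximate eigenvalue isolated from all but one eigenvalue,
is near the corresponding eigenvector. -/
theorem approx_eigenvector (b : OrthonormalBasis ι ℝ E) {D : E →ₗ[ℝ] E} {s : ι → ℝ}
    (hD : ∀ j, D (b j) = s j • b j) {l : ι} {lam γ ρ : ℝ} (hγ : 0 < γ)
    (hs : ∀ j, j ≠ l → γ ≤ |s j - lam|) {x : E} (hx : ‖D x - lam • x‖ ≤ ρ) :
    ‖x - ⟪b l, x⟫ • b l‖ ≤ ρ / γ ∧ |s l - lam| * |⟪b l, x⟫| ≤ ρ := by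
  have hin : ∀ j, ⟪b j, D x - lam • x⟫ = (s j - lam) * ⟪b j, x⟫ := fun j => by
    rw [inner_sub_right, inner_basis_map b hD, real_inner_smul_right]; ring
  constructor
  · rw [le_div_iff₀ hγ, mul_comm]
    refine le_trans ?_ hx
    refine le_of_sq_le_sq ?_ (norm_nonneg _)
    rw [mul_pow, norm_sq_basis b, norm_sq_basis b, Finset.mul_sum]
    refine Finset.sum_le_sum fun j _ => ?_
    rw [hin]
    rcases eq_or_ne j l with rfl | hj
    · rw [inner_sub_proj (b.norm_eq_one j)]
      simpa using sq_nonneg _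
    · rw [inner_sub_right, real_inner_smul_right, b.inner_eq_zero hj, mul_zero, sub_zero,
        mul_pow, ← sq_abs (s j - lam)]
      gcongr
      exact hs j hj
  · rw [← abs_mul, ← hin]
    refine (abs_real_inner_le_norm _ _).trans ?_
    rwa [b.norm_eq_one, one_mul]

namespace LeadingPair

variable {T : E →ₗ[ℝ] E} {lam mu : ℝ} {v : E}

theorem quadratic_le' (h : LeadingPair T lam mu v) (x : E) :
    ⟪T x, x⟫ ≤ lam * ⟪v, x⟫ ^ 2 + mu * (‖x‖ ^ 2 - ⟪v, x⟫ ^ 2) := by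
  have h1 := h.perp _ (inner_sub_proj h.unit x)
  have h2 := abs_real_inner_le_norm (T (x - ⟪v, x⟫ • v)) (x - ⟪v, x⟫ • v)
  have h3 := le_abs_self ⟪T (x - ⟪v, x⟫ • v), x - ⟪v, x⟫ • v⟫
  have h4 : ⟪T (x - ⟪v, x⟫ • v), x - ⟪v, x⟫ • v⟫ = ⟪T x, x⟫ - lam * ⟪v, x⟫ ^ 2 := by
    rw [h.map_sub_proj, inner_sub_left, inner_sub_right, real_inner_smul_left,
      inner_sub_proj h.unit, real_inner_smul_right, real_inner_comm v (T x),
      h.inner_map]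
    ring
  rw [← norm_sq_sub_proj h.unit]
  have h5 := mul_le_mul_of_nonneg_right h1 (norm_nonneg (x - ⟪v, x⟫ • v))
  nlinarith

theorem quadratic_le (h : LeadingPair T lam mu v) (x : E) : ⟪T x, x⟫ ≤ lam * ‖x‖ ^ 2 := by
  have h1 := h.quadratic_le' x
  have h2 := norm_sq_sub_proj h.unit x
  have h3 := sq_nonneg ‖x - ⟪v, x⟫ • v‖
  have := h.lt
  nlinarith

/-- A unit vector that maximizes the Rayleigh quotient is `± v`. -/
theorem eq_of_maximizer (h : LeadingPair T lam mu v) {x : E} (hx : ‖x‖ = 1)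
    (hmax : lam ≤ ⟪T x, x⟫) : x = ⟪v, x⟫ • v := by
  have h1 := h.quadratic_le' x
  have h2 := norm_sq_sub_proj h.unit x
  have h3 := h.lt
  rw [hx] at h1 h2
  have h4 : ‖x - ⟪v, x⟫ • v‖ ^ 2 ≤ 0 := by rw [h2]; nlinarith
  have h5 : ‖x - ⟪v, x⟫ • v‖ = 0 := by
    have := sq_nonneg ‖x - ⟪v, x⟫ • v‖
    exact pow_eq_zero_iff (two_ne_zero) |>.1 (le_antisymm h4 this)
  exact sub_eq_zero.1 (norm_eq_zero.1 h5)

end LeadingPair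

theorem exists_max_eigenvector [FiniteDimensional ℝ E] [Nontrivial E] {T : E →ₗ[ℝ] E}
    (hT : T.IsSymmetric) :
    ∃ (lam : ℝ) (v : E), ‖v‖ = 1 ∧ T v = lam • v ∧ ∀ x, ⟪T x, x⟫ ≤ lam * ‖x‖ ^ 2 := by
  have hpos : 0 < Module.finrank ℝ E := Module.finrank_pos
  have : Nonempty (Fin (Module.finrank ℝ E)) := ⟨⟨0, hpos⟩⟩
  obtain ⟨i, hi⟩ := Finite.exists_max (hT.eigenvalues rfl)
  exact ⟨hT.eigenvalues rfl i, hT.eigenvectorBasis rfl i, (hT.eigenvectorBasis rfl).norm_eq_one i,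
    hT.apply_eigenvectorBasis rfl i,
    fun x => quadratic_le (hT.eigenvectorBasis rfl) (hT.apply_eigenvectorBasis rfl) hi x⟩

/-- A small symmetric perturbation of an operator with an isolated largest eigenvalue has a
leading eigenpair. -/
theorem exists_leadingPair (b : OrthonormalBasis ι ℝ E) {D T : E →ₗ[ℝ] E} {s : ι → ℝ}
    (hD : ∀ j, D (b j) = s j • b j) (hT : T.IsSymmetric) {l : ι} {σ' Γ Δ : ℝ}
    (hσ' : 0 ≤ σ') (hs0 : ∀ j, 0 ≤ s j) (hs : ∀ j, j ≠ l → s j ≤ σ') (hl : 0 < s l)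
    (hΓ : 1 ≤ Γ) (hgap : s l ≤ Γ * (s l - σ')) (hΔ : Δ ≤ s l / (16 * Γ ^ 2))
    (hTD : ∀ x, ‖T x - D x‖ ≤ Δ * ‖x‖) :
    ∃ lam mu v, LeadingPair T lam mu v ∧ |lam - s l| ≤ Δ ∧ 1 / (4 * Γ) ≤ 1 - mu / lam := by
  have : FiniteDimensional ℝ E := b.toBasis.finiteDimensional_of_finite
  have hbl := b.norm_eq_one l
  have : Nontrivial E := ⟨b l, 0, by rintro h; simp [h] at hbl⟩
  obtain ⟨lam, v, hv, hTv, hmax⟩ := exists_max_eigenvector hT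
  have hΔ0 : 0 ≤ Δ := by simpa [hbl] using (norm_nonneg _).trans (hTD (b l))
  have hgap0 : 0 < s l - σ' := by
    by_contra hc
    push Not at hc
    nlinarith
  have hsl : ∀ j, s j ≤ s l := fun j => by
    rcases eq_or_ne j l with rfl | hj
    · rfl
    · linarith [hs j hj]
  rw [le_div_iff₀ (by positivity)] at hΔ
  have hΔΓ : 16 * (Γ * Δ) ≤ s l - σ' := by
    -- The square of `Γ` in the hypothesis is needed so that `Γ Δ`, not only `Δ`, is small against
    -- the gap: tilting the eigenvector by `Δ/gap` moves the norm on the complement by about `Γ Δ`.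
    have : Γ * (16 * (Γ * Δ)) ≤ Γ * (s l - σ') := by nlinarith
    exact le_of_mul_le_mul_left this (by linarith)
  have hΔΓ' : Δ ≤ Γ * Δ := le_mul_of_one_le_left hΔ0 hΓ
  -- Weyl's inequality for the largest eigenvalue: test `T` on `b l` here, and `D` on `v` for the
  -- upper bound.
  have hlow : s l - Δ ≤ lam := by
    have h1 := hmax (b l)
    have h2 := (abs_real_inner_le_norm (T (b l) - D (b l)) (b l)).trans
      (mul_le_mul_of_nonneg_right (hTD (b l)) (norm_nonneg _))
    rw [inner_sub_left, hD, real_inner_smul_left, real_inner_self_eq_norm_sq, hbl, abs_le] at h2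
    rw [hbl] at h1
    linarith [h2.1]
  have hupp : lam ≤ s l + Δ := by
    have h1 := quadratic_le b hD hsl v
    have h2 := (abs_real_inner_le_norm (T v - D v) v).trans
      (mul_le_mul_of_nonneg_right (hTD v) (norm_nonneg _))
    rw [inner_sub_left, hTv, real_inner_smul_left, real_inner_self_eq_norm_sq, hv, abs_le] at h2
    rw [hv] at h1
    linarith [h2.2]
  have hlam : 0 < lam := by linarith
  have happ := approx_eigenvector b hD (l := l) (lam := lam) (γ := (s l - σ') / 2) (ρ := Δ)
    (x := v) (by linarith) (fun j hj => by
      rw [abs_sub_comm]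
      exact le_trans (by linarith [hs j hj]) (le_abs_self _)) (by
      rw [← hTv, norm_sub_rev]
      simpa [hv] using hTD v)
  have hnear := min_norm_sub_add_le hbl hv happ.1
  set δ := 2 * (Δ / ((s l - σ') / 2)) with hδ
  have hslδ : s l * δ ≤ 4 * (Γ * Δ) := by
    have : s l * δ = 4 * (s l / (s l - σ')) * Δ := by rw [hδ]; field_simp; norm_num; ring
    rw [this]
    have : s l / (s l - σ') ≤ Γ := by rwa [div_le_iff₀ hgap0]
    calc _ ≤ 4 * Γ * Δ := by gcongr
      _ = _ := by ring
  have hperp : ∀ y, ⟪v, y⟫ = 0 → |⟪b l, y⟫| ≤ δ * ‖y‖ := by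
    intro y hy
    rcases min_le_iff.1 hnear with h | h
    · have : ⟪b l, y⟫ = ⟪b l - v, y⟫ := by rw [inner_sub_left, hy, sub_zero]
      rw [this]
      exact (abs_real_inner_le_norm _ _).trans (by gcongr)
    · have : ⟪b l, y⟫ = ⟪b l + v, y⟫ := by rw [inner_add_left, hy, add_zero]
      rw [this]
      exact (abs_real_inner_le_norm _ _).trans (by gcongr)
  have hmulam : (s l - σ') / 2 ≤ lam - (σ' + 5 * (Γ * Δ)) := by linarith
  -- On the complement of `v`, `D` costs `σ'` plus `4 Γ Δ` from the tilt of `v` against `b l`, and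
  -- `T - D` costs `Δ ≤ Γ Δ`.
  refine ⟨lam, σ' + 5 * (Γ * Δ), v, ⟨hT, hv, hTv, by positivity, by linarith, ?_⟩, ?_, ?_⟩
  · intro y hy
    have h1 := norm_map_le b hD hσ' hl.le (l := l)
      (fun j hj => by rw [abs_of_nonneg (hs0 j)]; exact hs j hj) y
    have h2 := hTD y
    have h3 : ‖T y‖ ≤ ‖T y - D y‖ + ‖D y‖ := by
      simpa using norm_add_le (T y - D y) (D y)
    have h4 : s l * |⟪b l, y⟫| ≤ 4 * (Γ * Δ) * ‖y‖ := by
      calc s l * |⟪b l, y⟫| ≤ s l * (δ * ‖y‖) := by gcongr; exact hperp y hy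
        _ = s l * δ * ‖y‖ := by ring
        _ ≤ _ := by gcongr
    have h5 : Δ * ‖y‖ ≤ Γ * Δ * ‖y‖ := by gcongr
    linarith
  · rw [abs_le]; constructor <;> linarith
  · rw [one_sub_div hlam.ne', div_le_div_iff₀ (by positivity) hlam]
    nlinarith

end Perturbation

/-! ### Error propagation through deflation -/

theorem toEuclideanLin_outer {n : ℕ} (x z : Vec n) :
    (outer x).toEuclideanLin z = ⟪x, z⟫ • x := by
  ext i
  simp only [Matrix.toLpLin_apply, Matrix.mulVec, dotProduct, outer, Matrix.of_apply,
    PiLp.smul_apply, smul_eq_mul, PiLp.inner_apply, RCLike.inner_apply, conj_trivial]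
  rw [Finset.sum_mul]
  exact Finset.sum_congr rfl fun j _ => by ring

theorem isSymm_outer {n : ℕ} (x : Vec n) : (outer x).IsSymm := by
  ext i j
  simp [outer, mul_comm]

theorem isSymmetric_toEuclideanLin {n : ℕ} {A : Matrix (Fin n) (Fin n) ℝ} (hA : A.IsSymm) :
    A.toEuclideanLin.IsSymmetric := by
  rw [Matrix.isSymmetric_toEuclideanLin_iff, Matrix.IsHermitian,
    Matrix.conjTranspose_eq_transpose_of_trivial]
  exact hA

/-- A matrix with the eigenbasis `b`, together with the tolerances of sequential deflation:
`δ` for the eigenpairs, `η` for one deflation step, `τ` for the angle reached in one stage. -/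
structure DeflationData (n k : ℕ) (M : Matrix (Fin n) (Fin n) ℝ) (σ : ℕ → ℝ)
    (b : OrthonormalBasis (Fin n) ℝ (Vec n)) (Γ δ η τ : ℝ) : Prop where
  symm : M.IsSymm
  eig : ∀ j, M.toEuclideanLin (b j) = σ j • b j
  anti : Antitone σ
  nonneg : ∀ i, 0 ≤ σ i
  pos : 0 < σ (k - 1)
  le_dim : k ≤ n
  one_le : 1 ≤ Γ
  gap : ∀ i, i < k → σ i ≤ Γ * (σ i - σ (i + 1))
  delta_nonneg : 0 ≤ δ
  delta_le : δ ≤ 1 / 2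
  tau_nonneg : 0 ≤ τ
  perturbation_le : 3 * k * δ * σ 0 ≤ σ (k - 1) / (16 * Γ ^ 2)
  angle_le : 16 * τ * σ 0 ≤ η
  residual_le : 4 * (10 * k ^ 2 * (σ 0 / σ (k - 1)) * η) * Γ ≤ δ * σ (k - 1)

/-- The `i`-th vector of a basis indexed by `Fin n`, and `0` for `i ≥ n`. -/
def basisVec {n : ℕ} (b : OrthonormalBasis (Fin n) ℝ (Vec n)) (i : ℕ) : Vec n :=
  if h : i < n then b ⟨i, h⟩ else 0

theorem basisVec_fin {n : ℕ} (b : OrthonormalBasis (Fin n) ℝ (Vec n)) (j : Fin n) :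
    basisVec b j = b j := by
  simp [basisVec]

/-- `M - ∑_{i < ℓ} sᵢ xᵢ xᵢᵀ`. -/
def subtractRankOnes {n : ℕ} (M : Matrix (Fin n) (Fin n) ℝ) (s : ℕ → ℝ) (x : ℕ → Vec n) (ℓ : ℕ) :
    Matrix (Fin n) (Fin n) ℝ :=
  M - ∑ i ∈ Finset.range ℓ, s i • outer (x i)

theorem subtractRankOnes_succ {n : ℕ} (M : Matrix (Fin n) (Fin n) ℝ) (s : ℕ → ℝ) (x : ℕ → Vec n)
    (ℓ : ℕ) : subtractRankOnes M s x (ℓ + 1) = subtractRankOnes M s x ℓ - s ℓ • outer (x ℓ) := by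
  rw [subtractRankOnes, subtractRankOnes, Finset.sum_range_succ, sub_sub]

theorem subtractRankOnes_apply {n : ℕ} (M : Matrix (Fin n) (Fin n) ℝ) (s : ℕ → ℝ) (x : ℕ → Vec n)
    (ℓ : ℕ) (z : Vec n) : (subtractRankOnes M s x ℓ).toEuclideanLin z =
      M.toEuclideanLin z - ∑ i ∈ Finset.range ℓ, s i • ⟪x i, z⟫ • x i := by
  induction ℓ with
  | zero => simp [subtractRankOnes]
  | succ ℓ ih =>
    rw [subtractRankOnes_succ, map_sub, LinearMap.sub_apply, ih, map_smul, LinearMap.smul_apply,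
      toEuclideanLin_outer, Finset.sum_range_succ, sub_sub]

theorem isSymm_subtractRankOnes {n : ℕ} {M : Matrix (Fin n) (Fin n) ℝ} (hM : M.IsSymm) (s : ℕ → ℝ)
    (x : ℕ → Vec n) (ℓ : ℕ) : (subtractRankOnes M s x ℓ).IsSymm := by
  induction ℓ with
  | zero => simpa [subtractRankOnes] using hM
  | succ ℓ ih =>
    rw [subtractRankOnes_succ]
    exact ih.sub ((isSymm_outer _).smul _)

theorem deflated_eq {n : ℕ} (M : Matrix (Fin n) (Fin n) ℝ) (g : ℕ → Vec n) (t : ℕ → ℕ) (ℓ : ℕ) :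
    deflated M g t ℓ = subtractRankOnes M (sigmaHat M g t) (uHat M g t) ℓ := by
  induction ℓ with
  | zero => simp [subtractRankOnes, deflated]
  | succ ℓ ih =>
    rw [subtractRankOnes_succ, ← ih]
    rfl

namespace DeflationData

variable {n k : ℕ} {M : Matrix (Fin n) (Fin n) ℝ} {σ : ℕ → ℝ}
  {b : OrthonormalBasis (Fin n) ℝ (Vec n)} {Γ δ η τ : ℝ}

/-- Exact deflation removes the leading eigenvalues. -/
theorem exact_apply (d : DeflationData n k M σ b Γ δ η τ) (ℓ : ℕ) (j : Fin n) :
    (subtractRankOnes M σ (basisVec b) ℓ).toEuclideanLin (b j) =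
      (if (j : ℕ) < ℓ then 0 else σ j) • b j := by
  rw [subtractRankOnes_apply, d.eig]
  have h0 : ∀ i : ℕ, i ≠ j → σ i • ⟪basisVec b i, b j⟫ • basisVec b i = 0 := by
    intro i hi
    by_cases h : i < n
    · have : basisVec b i = b ⟨i, h⟩ := by simp [basisVec, h]
      rw [this, b.inner_eq_zero (by intro hc; exact hi (by rw [← hc])), zero_smul, smul_zero]
    · simp [basisVec, h]
  have h1 : σ j • ⟪basisVec b j, b j⟫ • basisVec b j = σ j • b j := by
    rw [basisVec_fin, real_inner_self_eq_norm_sq, b.norm_eq_one, one_pow, one_smul]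
  split_ifs with h
  · rw [Finset.sum_eq_single (j : ℕ) (fun i _ hi => h0 i hi)
      (fun hj => absurd (Finset.mem_range.2 h) hj), h1]
    module
  · rw [Finset.sum_eq_zero fun i hi => h0 i (by
      have := Finset.mem_range.1 hi
      omega), sub_zero]

theorem le_of_lt (d : DeflationData n k M σ b Γ δ η τ) {i : ℕ} (hi : i < k) :
    σ (k - 1) ≤ σ i := d.anti (by omega)

/-- A matrix near the exactly deflated matrix has a leading eigenpair. -/
theorem exists_leadingPair_of_near (d : DeflationData n k M σ b Γ δ η τ) {ℓ : ℕ} (hℓ : ℓ < k)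
    {A : Matrix (Fin n) (Fin n) ℝ} (hA : A.IsSymm)
    (hnear : ∀ z, ‖A.toEuclideanLin z -
      (subtractRankOnes M σ (basisVec b) ℓ).toEuclideanLin z‖ ≤ 3 * k * δ * σ 0 * ‖z‖) :
    ∃ lam mu v, LeadingPair A.toEuclideanLin lam mu v ∧ |lam - σ ℓ| ≤ 3 * k * δ * σ 0 ∧
      1 / (4 * Γ) ≤ 1 - mu / lam := by
  have hℓn : ℓ < n := hℓ.trans_le d.le_dim
  have hσ := d.le_of_lt hℓ
  have hΓ := d.one_le
  have := exists_leadingPair b (d.exact_apply ℓ) (isSymmetric_toEuclideanLin hA) (l := ⟨ℓ, hℓn⟩)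
    (σ' := σ (ℓ + 1)) (Γ := Γ) (Δ := 3 * k * δ * σ 0) (d.nonneg _) (fun j => by
      split_ifs
      · exact le_rfl
      · exact d.nonneg _) (fun j hj => by
      split_ifs with h
      · exact d.nonneg _
      · refine d.anti ?_
        have : (j : ℕ) ≠ ℓ := fun hc => hj (Fin.ext hc)
        omega) (by simpa using d.pos.trans_le hσ) hΓ (by simpa using d.gap ℓ hℓ)
      (by
        simp only [lt_irrefl, if_false]
        refine d.perturbation_le.trans ?_
        gcongr) hnear
  simpa using this

/-- The state of sequential deflation before stage `ℓ`. -/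
structure Invariant (k : ℕ) (M : Matrix (Fin n) (Fin n) ℝ) (σ : ℕ → ℝ)
    (b : OrthonormalBasis (Fin n) ℝ (Vec n)) (δ η : ℝ) (s : ℕ → ℝ) (x : ℕ → Vec n)
    (ℓ : ℕ) : Prop where
  unit : ∀ i < ℓ, ‖x i‖ = 1
  value : ∀ i < ℓ, |σ i - s i| ≤ δ * σ i
  vector : ∀ i < ℓ, min ‖basisVec b i - x i‖ ‖basisVec b i + x i‖ ≤ δ
  small : ∀ i < ℓ, ‖(subtractRankOnes M s x ℓ).toEuclideanLin (x i)‖ ≤ 2 * ℓ * η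

variable {s : ℕ → ℝ} {x : ℕ → Vec n} {ℓ : ℕ}

theorem norm_basisVec (b : OrthonormalBasis (Fin n) ℝ (Vec n)) {i : ℕ} (hi : i < n) :
    ‖basisVec b i‖ = 1 := by
  rw [basisVec, dif_pos hi, b.norm_eq_one]

/-- Each subtracted term errs by at most `δ σ₀` in value and `2 δ σ₀` in direction; sum over at most
`k` terms. The bound is crude and serves only to isolate the leading eigenvalue. -/
theorem Invariant.near (d : DeflationData n k M σ b Γ δ η τ) (I : Invariant k M σ b δ η s x ℓ)
    (hℓ : ℓ ≤ k) (z : Vec n) :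
    ‖(subtractRankOnes M s x ℓ).toEuclideanLin z -
      (subtractRankOnes M σ (basisVec b) ℓ).toEuclideanLin z‖ ≤ 3 * k * δ * σ 0 * ‖z‖ := by
  have hδ := d.delta_nonneg
  rw [subtractRankOnes_apply, subtractRankOnes_apply, sub_sub_sub_cancel_left,
    ← Finset.sum_sub_distrib]
  have h1 : ∀ i ∈ Finset.range ℓ, ‖σ i • ⟪basisVec b i, z⟫ • basisVec b i -
      s i • ⟪x i, z⟫ • x i‖ ≤ 3 * δ * σ 0 * ‖z‖ := by
    intro i hi
    have hi := Finset.mem_range.1 hi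
    have hin : i < n := by have := d.le_dim; omega
    refine (norm_rankOne_sub_le (norm_basisVec b hin) (I.unit i hi) (d.nonneg i)
      (I.vector i hi) z).trans ?_
    have h2 := I.value i hi
    have h3 : δ * σ i ≤ δ * σ 0 := mul_le_mul_of_nonneg_left (d.anti (Nat.zero_le i)) hδ
    gcongr
    linarith
  refine (norm_sum_le_of_le _ h1).trans ?_
  have h0 := d.nonneg 0
  rw [Finset.sum_const, Finset.card_range, nsmul_eq_mul]
  calc (ℓ : ℝ) * (3 * δ * σ 0 * ‖z‖) ≤ k * (3 * δ * σ 0 * ‖z‖) := by gcongr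
    _ = _ := by ring

theorem Invariant.zero : Invariant k M σ b δ η s x 0 :=
  ⟨fun _ h => absurd h (Nat.not_lt_zero _), fun _ h => absurd h (Nat.not_lt_zero _),
    fun _ h => absurd h (Nat.not_lt_zero _), fun _ h => absurd h (Nat.not_lt_zero _)⟩

section Step

variable {lam mu : ℝ} {v : Vec n}

theorem perturbation_bounds (d : DeflationData n k M σ b Γ δ η τ) (hℓ : ℓ < k)
    (hlam : |lam - σ ℓ| ≤ 3 * k * δ * σ 0) :
    |lam - σ ℓ| ≤ σ (k - 1) / (16 * Γ) ∧ σ ℓ / 2 ≤ lam ∧ lam ≤ 2 * σ 0 := by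
  have hΓ := d.one_le
  have hp := d.pos
  have h1 : σ (k - 1) / (16 * Γ ^ 2) ≤ σ (k - 1) / (16 * Γ) := by
    gcongr; nlinarith
  have h2 : σ (k - 1) / (16 * Γ) ≤ σ (k - 1) / 16 := by
    gcongr; linarith
  have h3 := d.le_of_lt hℓ
  have h4 := d.anti (Nat.zero_le ℓ)
  have h5 := d.perturbation_le
  have h6 := abs_le.1 hlam
  exact ⟨by linarith, by linarith, by linarith⟩

theorem eta_bound (d : DeflationData n k M σ b Γ δ η τ) (hlam : lam ≤ 2 * σ 0) :
    8 * τ * lam ≤ η := by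
  have := d.tau_nonneg
  have := d.angle_le
  nlinarith

/-- The split is exact deflation of the actual `M_ℓ`, which projects its output off `v`, plus the
small error of the estimated rank-one term. -/
theorem deflate_apply (h : LeadingPair (subtractRankOnes M s x ℓ).toEuclideanLin lam mu v)
    (z : Vec n) : (subtractRankOnes M s x (ℓ + 1)).toEuclideanLin z =
      ((subtractRankOnes M s x ℓ).toEuclideanLin z -
        ⟪v, (subtractRankOnes M s x ℓ).toEuclideanLin z⟫ • v) +
      (lam • ⟪v, z⟫ • v - s ℓ • ⟪x ℓ, z⟫ • x ℓ) := by
  rw [subtractRankOnes_succ, map_sub, LinearMap.sub_apply, map_smul, LinearMap.smul_apply,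
    toEuclideanLin_outer, h.inner_map]
  module

/-- Projecting off `v` does not increase the norm, so each stage only adds to the bound on `M_ℓ
x_i`, without an inverse gap. For `i = ℓ` the projected part is small because `x_ℓ` is almost
parallel to `v`. -/
theorem Invariant.small_succ (d : DeflationData n k M σ b Γ δ η τ)
    (I : Invariant k M σ b δ η s x ℓ)
    (h : LeadingPair (subtractRankOnes M s x ℓ).toEuclideanLin lam mu v) (hlam : lam ≤ 2 * σ 0)
    (o : StageOutput (subtractRankOnes M s x ℓ) lam τ v (s ℓ) (x ℓ)) :
    ∀ i < ℓ + 1, ‖(subtractRankOnes M s x (ℓ + 1)).toEuclideanLin (x i)‖ ≤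
      2 * (ℓ + 1 : ℕ) * η := by
  intro i hi
  have hη := d.eta_bound hlam
  have hτ := d.tau_nonneg
  have hl := h.pos
  have hη0 : 0 ≤ η := le_trans (by positivity) hη
  have hunit : ‖x i‖ = 1 := by
    rcases Nat.lt_succ_iff_lt_or_eq.1 hi with h1 | rfl
    · exact I.unit i h1
    · exact o.unit
  have h2 : ‖lam • ⟪v, x i⟫ • v - s ℓ • ⟪x ℓ, x i⟫ • x ℓ‖ ≤ η := by
    have := o.rankOne_near h (x i)
    rw [hunit, mul_one] at this
    linarith
  rw [deflate_apply h]
  refine (norm_add_le _ _).trans ?_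
  push_cast
  have hℓ0 : (0 : ℝ) ≤ ℓ := by positivity
  rcases Nat.lt_succ_iff_lt_or_eq.1 hi with h1 | rfl
  · have h3 := (norm_sub_proj_le h.unit _).trans (I.small i h1)
    linarith
  · rw [← h.map_sub_proj]
    have h3 := h.perp _ (inner_sub_proj h.unit (x i))
    have h4 : mu * ‖x i - ⟪v, x i⟫ • v‖ ≤ lam * τ :=
      mul_le_mul h.lt.le o.angle (norm_nonneg _) hl.le
    have h5 : lam * τ ≤ η := by nlinarith
    nlinarith

theorem Invariant.residual_le (d : DeflationData n k M σ b Γ δ η τ)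
    (I : Invariant k M σ b δ η s x ℓ) (hℓ : ℓ < k)
    (h : LeadingPair (subtractRankOnes M s x ℓ).toEuclideanLin lam mu v)
    (hlow : σ ℓ / 2 ≤ lam) (hupp : lam ≤ 2 * σ 0)
    (o : StageOutput (subtractRankOnes M s x ℓ) lam τ v (s ℓ) (x ℓ)) :
    ‖M.toEuclideanLin (x ℓ) - lam • x ℓ‖ ≤ 9 * k ^ 2 * (σ 0 / σ (k - 1)) * η := by
  have hη := d.eta_bound hupp
  have hτ := d.tau_nonneg
  have hl := h.pos
  have hη0 : 0 ≤ η := le_trans (by positivity) hη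
  have hp := d.pos
  have hσℓ := d.le_of_lt hℓ
  have hσ0 : σ (k - 1) ≤ σ 0 := d.anti (Nat.zero_le _)
  have hσ0p : 0 < σ 0 := hp.trans_le hσ0
  have hκ : 1 ≤ σ 0 / σ (k - 1) := by rwa [le_div_iff₀ hp, one_mul]
  have hk1 : (ℓ : ℝ) + 1 ≤ k := by exact_mod_cast hℓ
  have hk1' : (1 : ℝ) ≤ k := by
    have : (0 : ℝ) ≤ ℓ := by positivity
    linarith
  have hr := o.residual h
  have hr' : ‖(subtractRankOnes M s x ℓ).toEuclideanLin (x ℓ) - lam • x ℓ‖ ≤ η := by nlinarith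
  have hin : ∀ i < ℓ, |⟪x i, x ℓ⟫| ≤ 4 * k * η / σ (k - 1) := by
    intro i hi
    -- Symmetry of `M_ℓ` moves it onto `x i`, which it almost annihilates; dividing by `lam ≥ σ (k -
    -- 1) / 2` gives near orthogonality.
    have h1 : lam * ⟪x i, x ℓ⟫ = ⟪(subtractRankOnes M s x ℓ).toEuclideanLin (x i), x ℓ⟫ -
        ⟪x i, (subtractRankOnes M s x ℓ).toEuclideanLin (x ℓ) - lam • x ℓ⟫ := by
      rw [h.symm, inner_sub_right, real_inner_smul_right]; ring
    have h2 : lam * |⟪x i, x ℓ⟫| ≤ 2 * ℓ * η + η := by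
      have h3 : lam * |⟪x i, x ℓ⟫| = |lam * ⟪x i, x ℓ⟫| := by rw [abs_mul, abs_of_pos hl]
      rw [h3, h1]
      refine (abs_sub _ _).trans (add_le_add ?_ ?_)
      · refine (abs_real_inner_le_norm _ _).trans ?_
        rw [o.unit, mul_one]
        exact I.small i hi
      · refine (abs_real_inner_le_norm _ _).trans ?_
        rw [I.unit i hi, one_mul]
        exact hr'
    rw [le_div_iff₀ hp]
    have h3 : σ (k - 1) / 2 * |⟪x i, x ℓ⟫| ≤ lam * |⟪x i, x ℓ⟫| := by
      gcongr
      linarith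
    nlinarith
  have hs : ∀ i < ℓ, |s i| ≤ 2 * σ 0 := by
    intro i hi
    have h1 := abs_le.1 (I.value i hi)
    have h2 := d.anti (Nat.zero_le i)
    have h3 := d.delta_le
    have h4 := d.nonneg i
    rw [abs_le]
    constructor <;> nlinarith
  have hsum : ‖∑ i ∈ Finset.range ℓ, s i • ⟪x i, x ℓ⟫ • x i‖ ≤
      8 * k ^ 2 * (σ 0 / σ (k - 1)) * η := by
    have : ∀ i ∈ Finset.range ℓ, ‖s i • ⟪x i, x ℓ⟫ • x i‖ ≤
        2 * σ 0 * (4 * k * η / σ (k - 1)) := by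
      intro i hi
      have hi := Finset.mem_range.1 hi
      rw [norm_smul, norm_smul, I.unit i hi, mul_one, Real.norm_eq_abs, Real.norm_eq_abs]
      have := hin i hi
      have := hs i hi
      gcongr
    refine (norm_sum_le_of_le _ this).trans ?_
    rw [Finset.sum_const, Finset.card_range, nsmul_eq_mul]
    calc (ℓ : ℝ) * (2 * σ 0 * (4 * k * η / σ (k - 1)))
        ≤ k * (2 * σ 0 * (4 * k * η / σ (k - 1))) := by gcongr
      _ = _ := by ring
  -- Adding back the subtracted terms returns to `M`; near orthogonality makes them small at `x ℓ`.
  have e : M.toEuclideanLin (x ℓ) - lam • x ℓ =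
      ((subtractRankOnes M s x ℓ).toEuclideanLin (x ℓ) - lam • x ℓ) +
        ∑ i ∈ Finset.range ℓ, s i • ⟪x i, x ℓ⟫ • x i := by
    rw [subtractRankOnes_apply]; abel
  rw [e]
  refine (norm_add_le _ _).trans ((add_le_add hr' hsum).trans ?_)
  have h1 : 1 ≤ (k : ℝ) ^ 2 * (σ 0 / σ (k - 1)) := by
    have : 1 ≤ (k : ℝ) ^ 2 := one_le_pow₀ hk1'
    nlinarith
  nlinarith

/-- Each of the first `k` gaps is at least `σ (k - 1) / Γ`, and `lam` has moved from `σ ℓ` by at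
most a sixteenth of that. -/
theorem eigenvalue_separation (d : DeflationData n k M σ b Γ δ η τ) (hℓ : ℓ < k)
    (hlam : |lam - σ ℓ| ≤ σ (k - 1) / (16 * Γ)) {j : ℕ} (hj : j ≠ ℓ) :
    σ (k - 1) / (2 * Γ) ≤ |σ j - lam| := by
  have hΓ := d.one_le
  have hp := d.pos
  have e1 : σ (k - 1) / (2 * Γ) = σ (k - 1) / Γ / 2 := by field_simp
  have e2 : σ (k - 1) / (16 * Γ) = σ (k - 1) / Γ / 16 := by field_simp
  have hq : 0 < σ (k - 1) / Γ := by positivity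
  have gap : ∀ i < k, σ (k - 1) / Γ ≤ σ i - σ (i + 1) := fun i hi => by
    rw [div_le_iff₀ (by linarith), mul_comm]
    exact (d.le_of_lt hi).trans (d.gap i hi)
  rw [e2, abs_le] at hlam
  rw [e1]
  rcases lt_or_gt_of_ne hj with h | h
  · have h1 := gap j (h.trans hℓ)
    have h2 : σ ℓ ≤ σ (j + 1) := d.anti h
    exact le_trans (by linarith) (le_abs_self _)
  · have h1 := gap ℓ hℓ
    have h2 : σ j ≤ σ (ℓ + 1) := d.anti h
    rw [abs_sub_comm]
    exact le_trans (by linarith) (le_abs_self _)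

/-- The crude bound on `lam` only separates it from the other eigenvalues of `M`. The residual
against `M` then restores the full accuracy `δ`, so errors do not compound. -/
theorem Invariant.succ (d : DeflationData n k M σ b Γ δ η τ)
    (I : Invariant k M σ b δ η s x ℓ) (hℓ : ℓ < k)
    (h : LeadingPair (subtractRankOnes M s x ℓ).toEuclideanLin lam mu v)
    (hlam : |lam - σ ℓ| ≤ 3 * k * δ * σ 0)
    (o : StageOutput (subtractRankOnes M s x ℓ) lam τ v (s ℓ) (x ℓ)) :
    Invariant k M σ b δ η s x (ℓ + 1) := by
  obtain ⟨hclose, hlow, hupp⟩ := d.perturbation_bounds hℓ hlam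
  have hres := I.residual_le d hℓ h hlow hupp o
  have hp := d.pos
  have hΓ := d.one_le
  have hℓn : ℓ < n := hℓ.trans_le d.le_dim
  have hη := d.eta_bound hupp
  have hτ := d.tau_nonneg
  have hl := h.pos
  have hη0 : 0 ≤ η := le_trans (by positivity) hη
  have hσ0 : σ (k - 1) ≤ σ 0 := d.anti (Nat.zero_le _)
  have hκ : 1 ≤ σ 0 / σ (k - 1) := by rwa [le_div_iff₀ hp, one_mul]
  have hk1 : (1 : ℝ) ≤ k := by exact_mod_cast (Nat.zero_lt_of_lt hℓ)
  set ρ := 10 * (k : ℝ) ^ 2 * (σ 0 / σ (k - 1)) * η with hρ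
  have hρη : η ≤ ρ := by
    have h1 : 1 ≤ (k : ℝ) ^ 2 * (σ 0 / σ (k - 1)) := by
      have : 1 ≤ (k : ℝ) ^ 2 := one_le_pow₀ hk1
      nlinarith
    rw [hρ]
    nlinarith
  have hres' : ‖M.toEuclideanLin (x ℓ) - lam • x ℓ‖ ≤ ρ := by
    refine hres.trans ?_
    rw [hρ]
    gcongr
    norm_num
  have hρδ : 4 * ρ * Γ ≤ δ * σ (k - 1) := d.residual_le
  obtain ⟨a1, a2⟩ := approx_eigenvector b d.eig (l := ⟨ℓ, hℓn⟩) (γ := σ (k - 1) / (2 * Γ))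
    (by positivity) (fun j hj => d.eigenvalue_separation hℓ hclose (fun hc => hj (Fin.ext hc))) hres'
  have hb : b ⟨ℓ, hℓn⟩ = basisVec b ℓ := by simp [basisVec, hℓn]
  have hdiv : ρ / (σ (k - 1) / (2 * Γ)) ≤ δ / 2 := by
    rw [div_le_iff₀ (by positivity)]
    have : δ / 2 * (σ (k - 1) / (2 * Γ)) = (δ * σ (k - 1)) / (4 * Γ) := by field_simp; norm_num
    rw [this, le_div_iff₀ (by positivity)]
    linarith
  rw [hb] at a1 a2
  have hbu := norm_basisVec b hℓn
  have a3 := a1.trans hdiv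
  have hv : min ‖basisVec b ℓ - x ℓ‖ ‖basisVec b ℓ + x ℓ‖ ≤ δ :=
    (min_norm_sub_add_le hbu o.unit a3).trans (by linarith)
  -- A component bounded below lets the residual bound on `|σ ℓ - lam| * |⟪basisVec b ℓ, x ℓ⟫|`
  -- control the eigenvalue error.
  have hc : 1 / 2 ≤ |⟪basisVec b ℓ, x ℓ⟫| := by
    have h1 := norm_sq_sub_proj hbu (x ℓ)
    have h2 : ‖x ℓ - ⟪basisVec b ℓ, x ℓ⟫ • basisVec b ℓ‖ ^ 2 ≤ (1 / 2) ^ 2 := by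
      gcongr
      linarith [d.delta_le]
    rw [o.unit, ← sq_abs ⟪basisVec b ℓ, x ℓ⟫] at h1
    refine le_of_sq_le_sq ?_ (abs_nonneg _)
    linarith
  have hval : |σ ℓ - s ℓ| ≤ δ * σ ℓ := by
    have h1 : |σ ℓ - lam| ≤ 2 * ρ := by
      have h2 : |σ ℓ - lam| * (1 / 2) ≤ |σ ℓ - lam| * |⟪basisVec b ℓ, x ℓ⟫| := by gcongr
      have h3 : |σ ℓ - lam| * |⟪basisVec b ℓ, x ℓ⟫| ≤ ρ := a2
      linarith
    have h2 : |lam - s ℓ| ≤ ρ := by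
      have := o.value
      nlinarith
    have h3 : |σ ℓ - s ℓ| ≤ |σ ℓ - lam| + |lam - s ℓ| := abs_sub_le _ _ _
    have h4 : δ * σ (k - 1) ≤ δ * σ ℓ := mul_le_mul_of_nonneg_left (d.le_of_lt hℓ) d.delta_nonneg
    nlinarith
  refine ⟨fun i hi => ?_, fun i hi => ?_, fun i hi => ?_, I.small_succ d h hupp o⟩
  · rcases Nat.lt_succ_iff_lt_or_eq.1 hi with h1 | rfl
    · exact I.unit i h1
    · exact o.unit
  · rcases Nat.lt_succ_iff_lt_or_eq.1 hi with h1 | rfl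
    · exact I.value i h1
    · exact hval
  · rcases Nat.lt_succ_iff_lt_or_eq.1 hi with h1 | rfl
    · exact I.vector i h1
    · exact hv

end Step

end DeflationData

/-! ### Choice of tolerances -/

section Constants

variable {σ : ℕ → ℝ} {k : ℕ} {ε : ℝ}

theorem gap_le_maxGapRatio {i : ℕ} (hi : i < k) (hgap : ∀ i, i < k → σ (i + 1) < σ i) :
    σ i ≤ maxGapRatio σ k * (σ i - σ (i + 1)) := by
  have h1 : 0 < σ i - σ (i + 1) := sub_pos.2 (hgap i hi)
  rw [← div_le_iff₀ h1]
  exact le_ciSup (f := fun i : Fin k => σ i / (σ i - σ (i + 1))) (Set.finite_range _).bddAbove ⟨i, hi⟩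

theorem one_le_maxGapRatio (hk : 0 < k) (h0 : ∀ i, 0 ≤ σ i)
    (hgap : ∀ i, i < k → σ (i + 1) < σ i) : 1 ≤ maxGapRatio σ k := by
  have h1 := gap_le_maxGapRatio hk hgap
  have h2 := hgap 0 hk
  have h3 := h0 (0 + 1)
  by_contra hc
  push Not at hc
  nlinarith

theorem mul_maxGapRatio_le (hk : 0 < k) (hσ : ∀ i, i < k → 0 < σ i)
    (hgap : ∀ i, i < k → σ (i + 1) < σ i)
    (hε : ∀ i, i < k → ε ≤ (1 / 2) * ((σ i - σ (i + 1)) / σ i)) :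
    ε * maxGapRatio σ k ≤ 1 / 2 := by
  have : Nonempty (Fin k) := ⟨⟨0, hk⟩⟩
  obtain ⟨i, hi⟩ := exists_eq_ciSup_of_finite (f := fun i : Fin k => σ i / (σ i - σ (i + 1)))
  have h1 := hε i i.2
  have h2 : 0 < σ i - σ (i + 1) := sub_pos.2 (hgap i i.2)
  have h3 := hσ i i.2
  rw [maxGapRatio, ← hi]
  calc ε * (σ i / (σ i - σ (i + 1)))
      ≤ ((1 / 2) * ((σ i - σ (i + 1)) / σ i)) * (σ i / (σ i - σ (i + 1))) := by gcongr
    _ = 1 / 2 := by field_simp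

/-- `log ((σ₁/σ_k) Γ k/ε)`. -/
def logTerm (σ : ℕ → ℝ) (k : ℕ) (ε : ℝ) : ℝ :=
  Real.log (σ 0 / σ (k - 1) * maxGapRatio σ k * (k / ε))

theorem gapTerm_eq (σ : ℕ → ℝ) (k : ℕ) (ε : ℝ) :
    gapTerm σ k ε = maxGapRatio σ k * logTerm σ k ε := rfl

theorem one_le_scaleTerm (hanti : Antitone σ) (hpos : 0 < σ (k - 1)) : 1 ≤ scaleTerm σ k := by
  have h0 : σ (k - 1) ≤ σ 0 := hanti (Nat.zero_le _)
  have h1 : 1 ≤ σ 0 + 1 / σ (k - 1) := by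
    have h2 : σ (k - 1) + 1 / σ (k - 1) - 1 = ((σ (k - 1) - 1 / 2) ^ 2 + 3 / 4) / σ (k - 1) := by
      field_simp; ring
    have h3 : 0 ≤ ((σ (k - 1) - 1 / 2) ^ 2 + 3 / 4) / σ (k - 1) := by positivity
    linarith
  rw [scaleTerm, Real.le_log_iff_exp_le (by positivity)]
  exact le_mul_of_one_le_right (Real.exp_pos _).le h1

/-- The factor `e ≥ 2` inside the logarithm absorbs the factors `2` by which `lam` may leave the
range of the eigenvalues. -/
theorem add_inv_le_exp_scaleTerm (hanti : Antitone σ) (hpos : 0 < σ (k - 1)) {lam : ℝ}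
    (hlow : σ (k - 1) / 2 ≤ lam) (hupp : lam ≤ 2 * σ 0) :
    lam + 1 / lam ≤ Real.exp (scaleTerm σ k) := by
  have h0 : σ (k - 1) ≤ σ 0 := hanti (Nat.zero_le _)
  have h1 : 0 < σ 0 + 1 / σ (k - 1) := by
    have : 0 < σ 0 := hpos.trans_le h0
    positivity
  rw [scaleTerm, Real.exp_log (by positivity)]
  have h2 : 1 / lam ≤ 1 / (σ (k - 1) / 2) := one_div_le_one_div_of_le (by positivity) hlow
  have h3 : 1 / (σ (k - 1) / 2) = 2 * (1 / σ (k - 1)) := by field_simp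
  have h4 := Real.add_one_le_exp 1
  nlinarith

/-- The tolerances with which sequential deflation runs. -/
theorem exists_deflationData {n : ℕ} {M : Matrix (Fin n) (Fin n) ℝ}
    {b : OrthonormalBasis (Fin n) ℝ (Vec n)} (hM : M.IsSymm)
    (hb : ∀ j, M.toEuclideanLin (b j) = σ j • b j) (hanti : Antitone σ) (h0 : ∀ i, 0 ≤ σ i)
    (hk : 0 < k) (hkn : k ≤ n) (hσ : ∀ i, i < k → 0 < σ i)
    (hgap : ∀ i, i < k → σ (i + 1) < σ i) (hε0 : 0 < ε)
    (hε : ∀ i, i < k → ε ≤ (1 / 2) * ((σ i - σ (i + 1)) / σ i)) :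
    Real.log 2 ≤ logTerm σ k ε ∧ ∃ δ η, δ ≤ ε ∧
      DeflationData n k M σ b (maxGapRatio σ k) δ η (Real.exp (-(20 * logTerm σ k ε))) := by
  have hΓ := one_le_maxGapRatio hk h0 hgap
  have hεΓ := mul_maxGapRatio_le hk hσ hgap hε
  have hp : 0 < σ (k - 1) := hσ _ (by omega)
  have hσ0 : σ (k - 1) ≤ σ 0 := hanti (Nat.zero_le _)
  have hσ0p : 0 < σ 0 := hp.trans_le hσ0
  have hκ : 1 ≤ σ 0 / σ (k - 1) := by rwa [le_div_iff₀ hp, one_mul]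
  have hk1 : (1 : ℝ) ≤ k := by exact_mod_cast hk
  have hg : ∀ i, i < k → σ i ≤ maxGapRatio σ k * (σ i - σ (i + 1)) :=
    fun i hi => gap_le_maxGapRatio hi hgap
  unfold logTerm
  set Γ := maxGapRatio σ k
  set R := σ 0 / σ (k - 1) * Γ * (k / ε) with hR
  have hεi : 2 * Γ ≤ 1 / ε := by
    rw [le_div_iff₀ hε0]; linarith
  have hε1 : ε ≤ 1 / 2 := by nlinarith
  have hkε : 1 / ε ≤ k / ε := by gcongr
  have hκΓ : 1 ≤ σ 0 / σ (k - 1) * Γ := by nlinarith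
  have hRε : 1 / ε ≤ R := by
    have h1 : 0 < 1 / ε := by positivity
    rw [hR]
    nlinarith
  have hR2 : 2 ≤ R := by linarith
  have hRpos : 0 < R := by linarith
  have hτ : Real.exp (-(20 * Real.log R)) = 1 / R ^ 20 := by
    rw [Real.exp_neg, one_div, ← Real.rpow_natCast, Real.rpow_def_of_pos hRpos]
    norm_num [mul_comm]
  have hRk : (k : ℝ) * (σ 0 / σ (k - 1)) * Γ ≤ R := by
    have : 1 ≤ 1 / ε := by linarith
    have e : R = (k : ℝ) * (σ 0 / σ (k - 1)) * Γ * (1 / ε) := by rw [hR]; ring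
    rw [e]
    exact le_mul_of_one_le_right (by positivity) this
  -- With `R = (σ₀/σ_{k-1}) Γ k/ε`, the stage angle is `R⁻²⁰`; `δ` is of order `1/R`, and `η` is the
  -- least value allowed by `angle_le`.
  refine ⟨Real.log_le_log (by norm_num) hR2, 1 / (24 * R), 16 * (1 / R ^ 20) * σ 0, ?_, ?_⟩
  · rw [div_le_iff₀ (by positivity)]
    rw [div_le_iff₀ hε0] at hRε
    nlinarith
  rw [hτ]
  refine ⟨hM, hb, hanti, h0, hp, hkn, hΓ, hg, by positivity, ?_, by positivity, ?_, le_rfl, ?_⟩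
  · rw [div_le_div_iff₀ (by positivity) (by norm_num)]
    linarith
  -- Only `ε Γ ≤ 1/2` remains, which is the assumed bound of `ε` by half the relative gaps.
  · have e : 3 * k * (1 / (24 * R)) * σ 0 = ε * Γ * (σ (k - 1) / (8 * Γ ^ 2)) := by
      rw [hR]; field_simp; norm_num
    have e2 : σ (k - 1) / (16 * Γ ^ 2) = 1 / 2 * (σ (k - 1) / (8 * Γ ^ 2)) := by
      field_simp; norm_num
    rw [e, e2]
    gcongr
  · have h1 : (k : ℝ) ^ 2 * (σ 0 / σ (k - 1)) ^ 2 * Γ ≤ R ^ 2 := by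
      calc (k : ℝ) ^ 2 * (σ 0 / σ (k - 1)) ^ 2 * Γ
          ≤ (k : ℝ) ^ 2 * (σ 0 / σ (k - 1)) ^ 2 * Γ ^ 2 := by gcongr; nlinarith
        _ = ((k : ℝ) * (σ 0 / σ (k - 1)) * Γ) ^ 2 := by ring
        _ ≤ R ^ 2 := by gcongr
    -- The constant to beat is `640 · 24 = 15360 < 2¹⁴`, and `R ≥ 2`.
    have h2 : (16384 : ℝ) ≤ R ^ 14 := by
      calc (16384 : ℝ) = 2 ^ 14 := by norm_num
        _ ≤ R ^ 14 := by gcongr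
    have h2' : (16384 : ℝ) ≤ R ^ 17 := h2.trans (pow_le_pow_right₀ (by linarith) (by norm_num))
    calc 4 * (10 * k ^ 2 * (σ 0 / σ (k - 1)) * (16 * (1 / R ^ 20) * σ 0)) * Γ
        = 640 * ((k : ℝ) ^ 2 * (σ 0 / σ (k - 1)) ^ 2 * Γ) * (1 / R ^ 20) * σ (k - 1) := by
          field_simp; norm_num
      _ ≤ 640 * R ^ 2 * (1 / R ^ 20) * σ (k - 1) := by gcongr
      _ = (15360 / R ^ 17) * (1 / (24 * R)) * σ (k - 1) := by field_simp; norm_num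
      _ ≤ 1 * (1 / (24 * R)) * σ (k - 1) := by
          gcongr
          rw [div_le_one (by positivity)]
          linarith
      _ = _ := by ring

end Constants

/-! ### Induction over the stages -/

namespace DeflationData

variable {n k : ℕ} {M : Matrix (Fin n) (Fin n) ℝ} {σ : ℕ → ℝ}
  {b : OrthonormalBasis (Fin n) ℝ (Vec n)} {Γ δ η τ : ℝ}

theorem isSymm_deflated (hM : M.IsSymm) (g : ℕ → Vec n) (t : ℕ → ℕ) (ℓ : ℕ) :
    (deflated M g t ℓ).IsSymm := by
  rw [deflated_eq]
  exact isSymm_subtractRankOnes hM _ _ _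

/-- The matrix of stage `ℓ` is near the exactly deflated one. -/
def IsNear (k : ℕ) (M : Matrix (Fin n) (Fin n) ℝ) (σ : ℕ → ℝ)
    (b : OrthonormalBasis (Fin n) ℝ (Vec n)) (δ : ℝ) (ℓ : ℕ)
    (A : Matrix (Fin n) (Fin n) ℝ) : Prop :=
  ∀ z, ‖A.toEuclideanLin z - (subtractRankOnes M σ (basisVec b) ℓ).toEuclideanLin z‖ ≤
    3 * k * δ * σ 0 * ‖z‖

/-- If no draw is degenerate and every stage has enough iterations, all stages are accurate. -/
theorem invariant_of_le {L L' : ℝ}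
    (d : DeflationData n k M σ b Γ δ η (Real.exp (-(20 * L)))) (hL : Real.log 2 ≤ L)
    (hL' : 1 ≤ L')
    (hlam : ∀ lam, σ (k - 1) / 2 ≤ lam → lam ≤ 2 * σ 0 → lam + 1 / lam ≤ Real.exp L')
    {g : ℕ → Vec n} {t : ℕ → ℕ}
    (hg : ∀ ℓ < k, IsNear k M σ b δ ℓ (deflated M g t ℓ) → 0 < stageQuality M g t ℓ)
    (ht : ∀ ℓ < k, 600 / stageQuality M g t ℓ ^ 7 * (Γ * L) + 5 * L' ≤ t ℓ) :
    ∀ ℓ ≤ k, Invariant k M σ b δ η (sigmaHat M g t) (uHat M g t) ℓ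
  | 0, _ => Invariant.zero
  | ℓ + 1, hℓ => by
    have I := d.invariant_of_le hL hL' hlam hg ht ℓ (by omega)
    -- Positive quality is assumed only for matrices near exact deflation; the induction hypothesis
    -- supplies that nearness.
    have hnear := I.near d (by omega)
    rw [← deflated_eq] at hnear
    have hsymm := isSymm_deflated d.symm g t ℓ
    obtain ⟨lam, mu, v, h, h1, h2⟩ := d.exists_leadingPair_of_near hℓ hsymm hnear
    obtain ⟨-, hlow, hupp⟩ := d.perturbation_bounds hℓ h1
    have hσ := d.le_of_lt hℓ
    have o := stageOutput hsymm h (hg ℓ hℓ hnear) d.one_le h2 hL hL'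
      (hlam lam (by linarith) hupp) (ht ℓ hℓ)
    rw [deflated_eq] at h
    exact I.succ d hℓ h h1 (by rw [← deflated_eq]; exact o)

theorem quality_pos {L L' : ℝ}
    (d : DeflationData n k M σ b Γ δ η (Real.exp (-(20 * L)))) (hL : Real.log 2 ≤ L)
    (hL' : 1 ≤ L')
    (hlam : ∀ lam, σ (k - 1) / 2 ≤ lam → lam ≤ 2 * σ 0 → lam + 1 / lam ≤ Real.exp L')
    {g : ℕ → Vec n} {t : ℕ → ℕ}
    (hg : ∀ ℓ < k, IsNear k M σ b δ ℓ (deflated M g t ℓ) → 0 < stageQuality M g t ℓ)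
    (ht : ∀ ℓ < k, 600 / stageQuality M g t ℓ ^ 7 * (Γ * L) + 5 * L' ≤ t ℓ) {ℓ : ℕ} (hℓ : ℓ < k) :
    0 < stageQuality M g t ℓ := by
  refine hg ℓ hℓ ?_
  have hnear := (d.invariant_of_le hL hL' hlam hg ht ℓ hℓ.le).near d hℓ.le
  rw [← deflated_eq] at hnear
  exact hnear

end DeflationData

/-! ### Counts chosen from the draws -/

/-- The matrices of sequential deflation when the iteration count of a stage is chosen from its
matrix and its draw. -/
def adaptiveDeflated {n : ℕ} (M : Matrix (Fin n) (Fin n) ℝ) (g : ℕ → Vec n)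
    (T : Matrix (Fin n) (Fin n) ℝ → Vec n → ℕ) : ℕ → Matrix (Fin n) (Fin n) ℝ
  | 0 => M
  | ℓ + 1 => adaptiveDeflated M g T ℓ -
      estValue (adaptiveDeflated M g T ℓ) (g ℓ) (T (adaptiveDeflated M g T ℓ) (g ℓ)) •
        outer (estVector (adaptiveDeflated M g T ℓ) (g ℓ) (T (adaptiveDeflated M g T ℓ) (g ℓ)))

theorem exists_adaptive_counts {n : ℕ} (M : Matrix (Fin n) (Fin n) ℝ) (g : ℕ → Vec n)
    (T : Matrix (Fin n) (Fin n) ℝ → Vec n → ℕ) :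
    ∃ t : ℕ → ℕ, ∀ ℓ, t ℓ = T (deflated M g t ℓ) (g ℓ) := by
  refine ⟨fun ℓ => T (adaptiveDeflated M g T ℓ) (g ℓ), fun ℓ => ?_⟩
  have : deflated M g (fun ℓ => T (adaptiveDeflated M g T ℓ) (g ℓ)) ℓ =
      adaptiveDeflated M g T ℓ := by
    induction ℓ with
    | zero => rfl
    | succ ℓ ih => rw [deflated, adaptiveDeflated, ih]
  rw [this]

/-- Stage `ℓ` sees only earlier draws and counts. This yields independence from `g ℓ` and reduces
all counts to countably many tuples. -/
theorem deflated_congr {n : ℕ} {M : Matrix (Fin n) (Fin n) ℝ} {g g' : ℕ → Vec n} {t t' : ℕ → ℕ}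
    {ℓ : ℕ} (hg : ∀ i < ℓ, g i = g' i) (ht : ∀ i < ℓ, t i = t' i) :
    deflated M g t ℓ = deflated M g' t' ℓ := by
  induction ℓ with
  | zero => rfl
  | succ ℓ ih =>
    rw [deflated, deflated, ih (fun i hi => hg i (by omega)) (fun i hi => ht i (by omega)),
      hg ℓ (by omega), ht ℓ (by omega)]

/-! ### Degenerate draws have probability zero -/

instance matrixMeasurableSpace (n : ℕ) : MeasurableSpace (Matrix (Fin n) (Fin n) ℝ) :=
  inferInstanceAs (MeasurableSpace (Fin n → Fin n → ℝ))

instance matrixBorelSpace (n : ℕ) : BorelSpace (Matrix (Fin n) (Fin n) ℝ) :=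
  inferInstanceAs (BorelSpace (Fin n → Fin n → ℝ))

theorem stdGaussian_hyperplane {n : ℕ} {v : Vec n} (hv : v ≠ 0) :
    stdGaussian (Vec n) {g | ⟪v, g⟫ = 0} = 0 := by
  have h1 := IsGaussian.map_eq_gaussianReal (μ := stdGaussian (Vec n)) (innerSL ℝ v)
  have h2 : {g : Vec n | ⟪v, g⟫ = 0} = (innerSL ℝ v) ⁻¹' {0} := by
    ext g; simp
  rw [h2, ← Measure.map_apply (by fun_prop) (measurableSet_singleton _), h1,
    variance_dual_stdGaussian]
  have h3 : (‖innerSL ℝ v‖ ^ 2).toNNReal ≠ 0 := by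
    rw [innerSL_apply_norm]
    have := norm_pos_iff.2 hv
    have : 0 < ‖v‖ ^ 2 := by positivity
    exact (Real.toNNReal_pos.2 this).ne'
  have := nullSingletonClass_gaussianReal (μ := (stdGaussian (Vec n))[innerSL ℝ v]) h3
  exact measure_singleton _

theorem continuous_toEuclideanLin_apply {n : ℕ} {X : Type*} [TopologicalSpace X]
    {f : X → Matrix (Fin n) (Fin n) ℝ} {h : X → Vec n} (hf : Continuous f) (hh : Continuous h) :
    Continuous fun x => (f x).toEuclideanLin (h x) := by
  simp only [Matrix.toLpLin_apply]
  refine (PiLp.continuous_toLp 2 _).comp (Continuous.matrix_mulVec hf ?_)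
  exact (PiLp.continuous_ofLp 2 _).comp hh

/-- The draws that are orthogonal to some maximizer of the Rayleigh quotient. -/
def degenerateDraws (n : ℕ) : Set (Matrix (Fin n) (Fin n) ℝ × Vec n) :=
  {p | ∃ v : Vec n, ‖v‖ = 1 ∧
    (∀ w, ⟪p.1.toEuclideanLin w, w⟫ ≤ ⟪p.1.toEuclideanLin v, v⟫ * ‖w‖ ^ 2) ∧ ⟪v, p.2⟫ = 0}

/-- The set is a projection along the compact unit sphere of a closed set. Quantifying over
maximizers thus gives measurability without a measurable choice of eigenvector. -/
theorem isClosed_degenerateDraws (n : ℕ) : IsClosed (degenerateDraws n) := by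
  let Z : Set (Metric.sphere (0 : Vec n) 1 × (Matrix (Fin n) (Fin n) ℝ × Vec n)) :=
    {p | (∀ w, ⟪p.2.1.toEuclideanLin w, w⟫ ≤
      ⟪p.2.1.toEuclideanLin (p.1 : Vec n), (p.1 : Vec n)⟫ * ‖w‖ ^ 2) ∧ ⟪(p.1 : Vec n), p.2.2⟫ = 0}
  have hZ : IsClosed Z := by
    simp only [Z, Set.ofPred_and, Set.ofPred_forall]
    refine IsClosed.inter ?_ ?_
    · refine isClosed_iInter fun w => isClosed_le ?_ ?_
      · exact (continuous_toEuclideanLin_apply (by fun_prop) continuous_const).inner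
          continuous_const
      · exact ((continuous_toEuclideanLin_apply (by fun_prop) (by fun_prop)).inner
          (by fun_prop)).mul continuous_const
    · exact isClosed_eq (by fun_prop) continuous_const
  have : degenerateDraws n = Prod.snd '' Z := by
    ext p
    constructor
    · rintro ⟨v, hv, h1, h2⟩
      exact ⟨(⟨v, by simpa using hv⟩, p), ⟨h1, h2⟩, rfl⟩
    · rintro ⟨⟨v, p⟩, ⟨h1, h2⟩, rfl⟩
      exact ⟨v, by simp, h1, h2⟩
  rw [this]
  exact isClosedMap_snd_of_compactSpace _ hZ

section Measurability

variable {n : ℕ}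

theorem measurable_toEuclideanLin_apply {X : Type*} [MeasurableSpace X]
    {f : X → Matrix (Fin n) (Fin n) ℝ} {h : X → Vec n} (hf : Measurable f) (hh : Measurable h) :
    Measurable fun x => (f x).toEuclideanLin (h x) := by
  simp only [Matrix.toLpLin_apply]
  refine (WithLp.measurable_toLp 2 _).comp (measurable_pi_lambda _ fun i => ?_)
  simp only [Matrix.mulVec, dotProduct]
  refine Finset.measurable_sum _ fun j _ => ?_
  refine Measurable.mul ?_ ?_
  · exact (measurable_pi_apply j).comp ((measurable_pi_apply i).comp hf)
  · exact (measurable_pi_apply j).comp ((WithLp.measurable_ofLp 2 _).comp hh)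

theorem measurable_estimates {X : Type*} [MeasurableSpace X]
    {f : X → Matrix (Fin n) (Fin n) ℝ} {h : X → Vec n} (hf : Measurable f) (hh : Measurable h)
    (hsymm : ∀ x, (f x).IsSymm) (t : ℕ) : Measurable fun x => gdIterate (f x) (h x) t := by
  have happ : ∀ y : X → Vec n, Measurable y →
      Measurable fun x => (f x).toEuclideanLin (y x) := fun y hy =>
    measurable_toEuclideanLin_apply hf hy
  induction t with
  | zero => exact happ _ hh
  | succ t ih =>
    simp only [gdIterate_succ, gradStep_eq (hsymm _)]
    have := happ _ ih
    fun_prop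

theorem measurable_deflated {M : Matrix (Fin n) (Fin n) ℝ} (hM : M.IsSymm) (t : ℕ → ℕ) (ℓ : ℕ) :
    Measurable fun g : ℕ → Vec n => deflated M g t ℓ := by
  induction ℓ with
  | zero => exact measurable_const
  | succ ℓ ih =>
    have h1 := measurable_estimates ih (measurable_pi_apply ℓ)
      (fun g => DeflationData.isSymm_deflated hM g t ℓ) (t ℓ)
    have h0 : ∀ i j, Measurable fun g : ℕ → Vec n => deflated M g t ℓ i j := fun i j =>
      (measurable_pi_apply j).comp ((measurable_pi_apply i).comp ih)
    have h2 : ∀ i, Measurable fun g : ℕ → Vec n =>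
        estVector (deflated M g t ℓ) (g ℓ) (t ℓ) i := fun i => by
      unfold estVector
      simp only [PiLp.smul_apply]
      fun_prop
    have h3 : Measurable fun g : ℕ → Vec n => estValue (deflated M g t ℓ) (g ℓ) (t ℓ) := by
      unfold estValue
      fun_prop
    refine measurable_pi_lambda _ fun i => measurable_pi_lambda _ fun j => ?_
    exact (h0 i j).sub (h3.mul ((h2 i).mul (h2 j)))

end Measurability

namespace DeflationData

variable {n k : ℕ} {M : Matrix (Fin n) (Fin n) ℝ} {σ : ℕ → ℝ}
  {b : OrthonormalBasis (Fin n) ℝ (Vec n)} {Γ δ η τ : ℝ}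

theorem isClosed_isNear (k : ℕ) (M : Matrix (Fin n) (Fin n) ℝ) (σ : ℕ → ℝ)
    (b : OrthonormalBasis (Fin n) ℝ (Vec n)) (δ : ℝ) (ℓ : ℕ) :
    IsClosed {A | IsNear k M σ b δ ℓ A} := by
  unfold IsNear
  rw [Set.ofPred_forall]
  refine isClosed_iInter fun z => isClosed_le ?_ continuous_const
  exact ((continuous_toEuclideanLin_apply continuous_id continuous_const).sub
    continuous_const).norm

theorem isClosed_isSymm : IsClosed {A : Matrix (Fin n) (Fin n) ℝ | A.IsSymm} :=
  isClosed_eq (by fun_prop) continuous_id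

/-- The pairs of a matrix near the exactly deflated one and a degenerate draw for it. -/
def badPairs (k : ℕ) (M : Matrix (Fin n) (Fin n) ℝ) (σ : ℕ → ℝ)
    (b : OrthonormalBasis (Fin n) ℝ (Vec n)) (δ : ℝ) (ℓ : ℕ) :
    Set (Matrix (Fin n) (Fin n) ℝ × Vec n) :=
  Prod.fst ⁻¹' ({A | IsNear k M σ b δ ℓ A} ∩ {A | A.IsSymm}) ∩ degenerateDraws n

theorem measurableSet_badPairs (k : ℕ) (M : Matrix (Fin n) (Fin n) ℝ) (σ : ℕ → ℝ)
    (b : OrthonormalBasis (Fin n) ℝ (Vec n)) (δ : ℝ) (ℓ : ℕ) :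
    MeasurableSet (badPairs k M σ b δ ℓ) :=
  ((((isClosed_isNear k M σ b δ ℓ).inter isClosed_isSymm).preimage continuous_fst).inter
    (isClosed_degenerateDraws n)).measurableSet

/-- By Fubini it suffices to fix the matrix. Near exact deflation its maximizers are `± v`, so the
bad draws lie in one hyperplane. -/
theorem badPairs_null (d : DeflationData n k M σ b Γ δ η τ) {ℓ : ℕ} (hℓ : ℓ < k)
    (μ : Measure (Matrix (Fin n) (Fin n) ℝ)) :
    (μ.prod (stdGaussian (Vec n))) (badPairs k M σ b δ ℓ) = 0 := by
  rw [Measure.measure_prod_null (measurableSet_badPairs k M σ b δ ℓ)]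
  refine Filter.Eventually.of_forall fun A => ?_
  by_cases hA : IsNear k M σ b δ ℓ A ∧ A.IsSymm
  · obtain ⟨lam, mu, v, h, -, -⟩ := d.exists_leadingPair_of_near hℓ hA.2 hA.1
    refine measure_mono_null (fun g hg => ?_) (stdGaussian_hyperplane h.ne_zero)
    obtain ⟨-, w, hw, hmax, hwg⟩ := hg
    have h1 := hmax v
    have h2 : ⟪A.toEuclideanLin v, v⟫ = lam := by
      rw [h.map_eq, real_inner_smul_left, real_inner_self_eq_norm_sq, h.unit]; ring
    have h3 := h.eq_of_maximizer hw (by simpa [h2, h.unit] using h1)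
    have h4 : ⟪v, w⟫ ≠ 0 := by
      intro h0
      rw [h0, zero_smul] at h3
      simp [h3] at hw
    rw [h3, real_inner_smul_left] at hwg
    exact (mul_eq_zero.1 hwg).resolve_left h4
  · have : Prod.mk A ⁻¹' badPairs k M σ b δ ℓ = ∅ := by
      ext g
      simp only [Set.mem_preimage, Set.mem_empty_iff_false, iff_false]
      rintro ⟨h1, -⟩
      exact hA h1
    change stdGaussian (Vec n) (Prod.mk A ⁻¹' badPairs k M σ b δ ℓ) = 0
    rw [this, measure_empty]

theorem quality_pos_of_notMem (d : DeflationData n k M σ b Γ δ η τ) {ℓ : ℕ} (hℓ : ℓ < k)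
    {A : Matrix (Fin n) (Fin n) ℝ} (hA : A.IsSymm) {g : Vec n}
    (hg : (A, g) ∉ badPairs k M σ b δ ℓ) (hnear : IsNear k M σ b δ ℓ A) :
    0 < initQuality A (initPoint A g) := by
  obtain ⟨lam, mu, v, h, -, -⟩ := d.exists_leadingPair_of_near hℓ hA hnear
  refine initQuality_pos h fun h0 => hg ⟨⟨hnear, hA⟩, v, h.unit, fun w => ?_, h0⟩
  have h2 : ⟪A.toEuclideanLin v, v⟫ = lam := by
    rw [h.map_eq, real_inner_smul_left, real_inner_self_eq_norm_sq, h.unit]; ring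
  simp only [h2]
  exact h.quadratic_le w

/-- Almost surely, no stage has a degenerate draw, whatever the iteration counts. -/
theorem ae_quality_pos (d : DeflationData n k M σ b Γ δ η τ) {Ω : Type*} [MeasurableSpace Ω]
    {P : Measure Ω} [IsProbabilityMeasure P] {g : ℕ → Ω → Vec n}
    (hlaw : ∀ ℓ, ℓ < k → HasLaw (g ℓ) (stdGaussian (Vec n)) P)
    (hindep : iIndepFun (fun ℓ : Fin k => g ℓ) P) :
    ∀ᵐ ω ∂P, ∀ (t : ℕ → ℕ), ∀ ℓ < k, IsNear k M σ b δ ℓ (deflated M (g · ω) t ℓ) →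
      0 < stageQuality M (g · ω) t ℓ := by
  -- For fixed counts the stage matrix is a function of the earlier draws, so its joint law with `g
  -- ℓ` is a product.
  have key : ∀ (t : ℕ → ℕ) (ℓ : ℕ), ℓ < k → ∀ᵐ ω ∂P,
      (deflated M (g · ω) t ℓ, g ℓ ω) ∉ badPairs k M σ b δ ℓ := by
    intro t ℓ hℓ
    have hae : ∀ i : Fin k, AEMeasurable (g i) P := fun i => (hlaw i i.2).aemeasurable
    let S : Finset (Fin k) := Finset.univ.filter fun i => (i : ℕ) < ℓ
    let T : Finset (Fin k) := {⟨ℓ, hℓ⟩}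
    have hST : Disjoint S T := by
      rw [Finset.disjoint_singleton_right]
      simp [S]
    have hI := hindep.indepFun_finset₀ S T hST hae
    -- Extension by `0` is harmless: `deflated` at stage `ℓ` does not read these entries.
    let ext : (S → Vec n) → ℕ → Vec n := fun y i =>
      if h : ∃ hi : i < k, (⟨i, hi⟩ : Fin k) ∈ S then y ⟨⟨i, h.1⟩, h.2⟩ else 0
    have hext : Measurable ext := by
      refine measurable_pi_lambda _ fun i => ?_
      by_cases h : ∃ hi : i < k, (⟨i, hi⟩ : Fin k) ∈ S
      · simp only [ext, h, dite_true]
        exact measurable_pi_apply _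
      · simp only [ext, h, dite_false]
        exact measurable_const
    have hF : Measurable fun y : S → Vec n => deflated M (ext y) t ℓ :=
      (measurable_deflated d.symm t ℓ).comp hext
    have hG : Measurable fun y : T → Vec n => y ⟨⟨ℓ, hℓ⟩, by simp [T]⟩ := measurable_pi_apply _
    have hI2 := hI.comp hF hG
    have e1 : ((fun y : S → Vec n => deflated M (ext y) t ℓ) ∘ fun ω (i : S) => g i ω) =
        fun ω => deflated M (g · ω) t ℓ := by
      funext ω
      refine deflated_congr (fun i hi => ?_) fun _ _ => rfl
      have h : ∃ hi : i < k, (⟨i, hi⟩ : Fin k) ∈ S := ⟨hi.trans hℓ, by simp [S, hi]⟩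
      simp only [ext, h, dite_true]
    have e2 : ((fun y : T → Vec n => y ⟨⟨ℓ, hℓ⟩, by simp [T]⟩) ∘ fun ω (i : T) => g i ω) = g ℓ :=
      rfl
    have m1 : AEMeasurable (fun ω => deflated M (g · ω) t ℓ) P := by
      rw [← e1]
      exact hF.comp_aemeasurable (aemeasurable_pi_lambda _ fun i => hae i)
    rw [e1, e2] at hI2
    have hmap := (indepFun_iff_map_prod_eq_prod_map_map m1 (hlaw ℓ hℓ).aemeasurable).1 hI2
    rw [(hlaw ℓ hℓ).map_eq] at hmap
    have hnull := d.badPairs_null hℓ (P.map fun ω => deflated M (g · ω) t ℓ)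
    rw [← hmap] at hnull
    exact ae_of_ae_map (m1.prodMk (hlaw ℓ hℓ).aemeasurable) (measure_eq_zero_iff_ae_notMem.1 hnull)
  -- Counts may depend on `ω`, so one null set must serve all sequences. Only the first `ℓ` counts
  -- matter at stage `ℓ`, and such tuples are countable.
  have key2 : ∀ᵐ ω ∂P, ∀ (ℓ : ℕ) (p : Fin ℓ → ℕ), ℓ < k →
      (deflated M (g · ω) (fun i => if h : i < ℓ then p ⟨i, h⟩ else 0) ℓ, g ℓ ω) ∉
        badPairs k M σ b δ ℓ := by
    refine ae_all_iff.2 fun ℓ => ae_all_iff.2 fun p => ?_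
    by_cases hℓ : ℓ < k
    · filter_upwards [key (fun i => if h : i < ℓ then p ⟨i, h⟩ else 0) ℓ hℓ] with ω hω _ using hω
    · exact Filter.Eventually.of_forall fun ω h => absurd h hℓ
  filter_upwards [key2] with ω hω t ℓ hℓ hnear
  refine d.quality_pos_of_notMem hℓ (isSymm_deflated d.symm _ _ _) ?_ hnear
  have h1 := hω ℓ (fun i => t i) hℓ
  rwa [deflated_congr (g' := (g · ω)) (t' := t) (fun _ _ => rfl)
    (fun i hi => by simp [hi])] at h1

end DeflationData

/-! ### The eigenbasis of `M` and the main theorem -/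

theorem exists_basis_extension {n d : ℕ} {u : Fin d → Vec n} (hu : Orthonormal ℝ u) :
    d ≤ n ∧ ∃ b : OrthonormalBasis (Fin n) ℝ (Vec n), ∀ i : Fin d, basisVec b i = u i := by
  have hdn : d ≤ n := by
    simpa using hu.linearIndependent.fintype_card_le_finrank
  let v : Fin n → Vec n := fun j => if h : (j : ℕ) < d then u ⟨j, h⟩ else 0
  have hv : Orthonormal ℝ (({j : Fin n | (j : ℕ) < d} : Set (Fin n)).domRestrict v) := by
    have e : ({j : Fin n | (j : ℕ) < d} : Set (Fin n)).domRestrict v =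
        u ∘ fun j : ({j : Fin n | (j : ℕ) < d} : Set (Fin n)) => ⟨(j : Fin n), j.2⟩ := by
      funext j
      have hj : ((j : Fin n) : ℕ) < d := j.2
      simp [v, hj]
    rw [e]
    refine hu.comp _ fun i j h => ?_
    exact Subtype.ext (Fin.ext (by simpa using h))
  obtain ⟨b, hb⟩ := hv.exists_orthonormalBasis_extension_of_card_eq (by simp)
  refine ⟨hdn, b, fun i => ?_⟩
  have h1 := hb ⟨i, i.2.trans_le hdn⟩ i.2
  have h2 : (i : ℕ) < n := i.2.trans_le hdn
  simp [basisVec, h2, h1, v]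

theorem eigenbasis_of_sum {n d : ℕ} {M : Matrix (Fin n) (Fin n) ℝ} {σ : ℕ → ℝ} {u : Fin d → Vec n}
    (hM : M = ∑ i : Fin d, σ i • outer (u i)) (hzero : ∀ i, d ≤ i → σ i = 0)
    {b : OrthonormalBasis (Fin n) ℝ (Vec n)} (hdn : d ≤ n)
    (hb : ∀ i : Fin d, basisVec b i = u i) (j : Fin n) : M.toEuclideanLin (b j) = σ j • b j := by
  have hb' : ∀ i : Fin d, u i = b (Fin.castLE hdn i) := fun i => by
    rw [← hb i]; exact basisVec_fin b (Fin.castLE hdn i)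
  rw [hM, map_sum, LinearMap.sum_apply]
  simp only [map_smul, LinearMap.smul_apply, toEuclideanLin_outer, hb']
  by_cases hj : (j : ℕ) < d
  · rw [Finset.sum_eq_single ⟨j, hj⟩]
    · have : Fin.castLE hdn ⟨j, hj⟩ = j := rfl
      rw [this, real_inner_self_eq_norm_sq, b.norm_eq_one, one_pow, one_smul]
    · intro i _ hi
      rw [b.inner_eq_zero (by
        rintro rfl
        exact hi rfl), zero_smul, smul_zero]
    · simp
  · rw [hzero j (not_lt.1 hj), zero_smul]
    refine Finset.sum_eq_zero fun i _ => ?_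
    rw [b.inner_eq_zero (by
      rintro rfl
      exact hj i.2), zero_smul, smul_zero]

theorem isSymm_sum_outer {n d : ℕ} {M : Matrix (Fin n) (Fin n) ℝ} {σ : ℕ → ℝ} {u : Fin d → Vec n}
    (hM : M = ∑ i : Fin d, σ i • outer (u i)) : M.IsSymm := by
  rw [hM, Matrix.IsSymm, Matrix.transpose_sum]
  exact Finset.sum_congr rfl fun i _ => ((isSymm_outer _).smul _)

end

theorem mainTheorem1 :
    ∃ C₁ C₂ : ℝ → ℝ,
      (∀ q, 0 < q → 0 < C₁ q ∧ 0 < C₂ q) ∧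
      AntitoneOn C₁ (Set.Ioi 0) ∧ AntitoneOn C₂ (Set.Ioi 0) ∧
      ∀ (n d k : ℕ) (M : Matrix (Fin n) (Fin n) ℝ) (σ : ℕ → ℝ) (u : Fin d → Vec n)
        (_hM : M = ∑ i : Fin d, σ i • outer (u i)) (_hu : Orthonormal ℝ u)
        (_hσ : Antitone σ) (_hpos : ∀ i, i < d → 0 < σ i) (_hzero : ∀ i, d ≤ i → σ i = 0)
        (_hk : 0 < k) (hkd : k ≤ d) (_hgap : ∀ i, i < k → σ (i + 1) < σ i)
        (ε : ℝ) (_hε : 0 < ε) (_hεgap : ∀ i, i < k → ε ≤ (1 / 2) * ((σ i - σ (i + 1)) / σ i))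
        (Ω : Type*) [MeasurableSpace Ω] (P : Measure Ω) [IsProbabilityMeasure P]
        (g : ℕ → Ω → Vec n)
        (_hlaw : ∀ ℓ, ℓ < k → HasLaw (g ℓ) (stdGaussian (Vec n)) P)
        (_hindep : iIndepFun (fun ℓ : Fin k => g ℓ) P),
        ∀ᵐ ω ∂P,
          -- sufficiently many iterations in every stage give accuracy `ε` in every stage
          (∀ t : ℕ → ℕ,
            (∀ ℓ, ℓ < k →
              C₁ (stageQuality M (g · ω) t ℓ) * gapTerm σ k ε +
                C₂ (stageQuality M (g · ω) t ℓ) * scaleTerm σ k ≤ t ℓ) →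
            ∀ ℓ : Fin k, 0 < stageQuality M (g · ω) t ℓ ∧
              StageAccurate M (g · ω) t ε ℓ (σ ℓ) (u (Fin.castLE hkd ℓ))) ∧
          -- the total number of iterations
          (∃ (t : ℕ → ℕ) (q : ℝ), 0 < q ∧
            (∀ ℓ : Fin k, q ≤ stageQuality M (g · ω) t ℓ ∧
              StageAccurate M (g · ω) t ε ℓ (σ ℓ) (u (Fin.castLE hkd ℓ))) ∧
            (∑ ℓ ∈ Finset.range k, t ℓ : ℕ) ≤
              C₁ q * (k * gapTerm σ k ε) + C₂ q * (k * scaleTerm σ k)) := by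
  -- Twice the constants sufficient for one stage, so that rounding up to an integer is absorbed in
  -- the second part. At `q = 0` the first function takes the value `0`, so positivity of the
  -- quality must come from the almost sure event.
  refine ⟨fun q => 1200 / q ^ 7, fun _ => 10, fun q hq => ⟨by positivity, by norm_num⟩, ?_,
    antitoneOn_const, ?_⟩
  · intro a ha c _ hac
    have ha : 0 < a := ha
    simp only
    gcongr
  intro n d k M σ u hM hu hσ hpos hzero hk hkd hgap ε hε hεgap Ω _ P _ g hlaw hindep
  obtain ⟨hdn, b, hb⟩ := exists_basis_extension hu
  have hsymm := isSymm_sum_outer hM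
  have h0 : ∀ i, 0 ≤ σ i := fun i => by
    rcases lt_or_ge i d with h | h
    · exact (hpos i h).le
    · exact (hzero i h).ge
  have hσk : ∀ i, i < k → 0 < σ i := fun i hi => hpos i (hi.trans_le hkd)
  obtain ⟨hL, δ, η, hδ, D⟩ := exists_deflationData hsymm (eigenbasis_of_sum hM hzero hdn hb) hσ h0
    hk (hkd.trans hdn) hσk hgap hε hεgap
  have hL' := one_le_scaleTerm hσ D.pos
  have hlam : ∀ lam, σ (k - 1) / 2 ≤ lam → lam ≤ 2 * σ 0 →
      lam + 1 / lam ≤ Real.exp (scaleTerm σ k) :=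
    fun lam => add_inv_le_exp_scaleTerm hσ D.pos
  have hG : 0 ≤ gapTerm σ k ε := by
    rw [gapTerm_eq]
    have h1 := D.one_le
    have h2 := Real.log_two_gt_d9
    have h3 : 0 ≤ logTerm σ k ε := by linarith
    positivity
  filter_upwards [D.ae_quality_pos hlaw hindep] with ω hω
  have core : ∀ t : ℕ → ℕ, (∀ ℓ < k, 600 / stageQuality M (g · ω) t ℓ ^ 7 * gapTerm σ k ε +
      5 * scaleTerm σ k ≤ t ℓ) → ∀ ℓ : Fin k, 0 < stageQuality M (g · ω) t ℓ ∧
        StageAccurate M (g · ω) t ε ℓ (σ ℓ) (u (Fin.castLE hkd ℓ)) := by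
    intro t ht ℓ
    refine ⟨D.quality_pos hL hL' hlam (hω t) ht ℓ.2, ?_⟩
    have I := D.invariant_of_le hL hL' hlam (hω t) ht k le_rfl
    have h1 := I.value ℓ ℓ.2
    have h2 := I.vector ℓ ℓ.2
    have h3 := hb (Fin.castLE hkd ℓ)
    rw [Fin.val_castLE] at h3
    rw [h3] at h2
    exact ⟨h1.trans (mul_le_mul_of_nonneg_right hδ (h0 _)), h2.trans hδ⟩
  have hhalf : ∀ q : ℝ, 1200 / q ^ 7 * gapTerm σ k ε + 10 * scaleTerm σ k =
      2 * (600 / q ^ 7 * gapTerm σ k ε + 5 * scaleTerm σ k) := fun q => by ring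
  constructor
  · intro t ht
    refine core t fun ℓ hℓ => ?_
    have h1 := ht ℓ hℓ
    rw [hhalf] at h1
    have h2 : (0 : ℝ) ≤ t ℓ := by positivity
    linarith
  -- Each stage runs the least sufficient count for its own quality; the worst quality then bounds
  -- every count.
  · obtain ⟨t, ht⟩ := exists_adaptive_counts M (g · ω) fun A x =>
      ⌈600 / initQuality A (initPoint A x) ^ 7 * gapTerm σ k ε + 5 * scaleTerm σ k⌉₊
    have hcore := core t fun ℓ _ => by
      rw [ht ℓ]
      exact Nat.le_ceil _
    have : Nonempty (Fin k) := ⟨⟨0, hk⟩⟩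
    obtain ⟨i, hi⟩ := Finite.exists_min fun ℓ : Fin k => stageQuality M (g · ω) t ℓ
    refine ⟨t, stageQuality M (g · ω) t i, (hcore i).1, fun ℓ => ⟨hi ℓ, (hcore ℓ).2⟩, ?_⟩
    have hq := (hcore i).1
    set q := stageQuality M (g · ω) t i
    have hbound : ∀ ℓ ∈ Finset.range k,
        (t ℓ : ℝ) ≤ 1200 / q ^ 7 * gapTerm σ k ε + 10 * scaleTerm σ k := by
      intro ℓ hℓ
      have hqℓ : q ≤ stageQuality M (g · ω) t ℓ := hi ⟨ℓ, Finset.mem_range.1 hℓ⟩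
      have h1 : 600 / stageQuality M (g · ω) t ℓ ^ 7 * gapTerm σ k ε ≤
          600 / q ^ 7 * gapTerm σ k ε := by gcongr
      have h2 : 0 ≤ 600 / stageQuality M (g · ω) t ℓ ^ 7 * gapTerm σ k ε := by
        have := hq.trans_le hqℓ
        positivity
      have h3 : (t ℓ : ℝ) <
          600 / stageQuality M (g · ω) t ℓ ^ 7 * gapTerm σ k ε + 5 * scaleTerm σ k + 1 := by
        rw [ht ℓ]
        exact Nat.ceil_lt_add_one (add_nonneg h2 (by linarith))
      rw [hhalf]
      linarith
    push_cast
    refine (Finset.sum_le_sum hbound).trans (le_of_eq ?_)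
    rw [Finset.sum_const, Finset.card_range, nsmul_eq_mul]
    ring
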